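/- Let $n\ge 2$, let $\Omega\subseteq\mathbb{R}^n$ be a bounded open set, let $x_0\in\Omega$, and let $$T(\partial\Omega,x_0):=\{z\in\partial\Omega:\ |x_0-z|=\operatorname{dist}(\partial\Omega,x_0)\}.$$ For $z\in T(\partial\Omega,x_0)$ put $r:=|z-x_0|>0$ and define the spherical flatness index of $\partial\Omega$ at $z$ by $$S_z(\partial\Omega,x_0):=\frac{2}{n\omega_n r}\,\liminf_{R\searrow 0}\left(\liminf_{\substack{\alpha\to z\\ \alpha\notin\overline{\Omega}}}\int_{\partial\Omega\cap B(z,R)}\frac{\langle\alpha-x,\alpha-x_0\rangle}{|x-\alpha|^n}\,d\sigma(x)\right)\in[-\infty,+\infty],$$ where $\omega_n$ is the volume of the unit ball of $\mathbb{R}^n$ and $\sigma$ is the $(n-1)$-dimensional Hausdorff measure, normalized to agree with Lebesgue measure on $\mathbb{R}^{n-1}$. Write points of $\mathbb{R}^n=\mathbb{R}^{n-1}\times\mathbb{R}$ as $x=(x',x_n)$. The boundary $\partial\Omega$ is called Lipschitz flat at $z\in\partial\Omega$ if, possibly after applying a linear isometry of $\mathbb{R}^n$ to both $\Omega$ and $z$,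 there exist $R>0$, $-\infty<a<z_n<b<+\infty$ and a function $\psi:\widehat B_R(z')\to(a,b)$, where $\widehat B_R(z')=\{y\in\mathbb{R}^{n-1}:|y-z'|<R\}$, such that, with $U:=\widehat B_R(z')\times(a,b)$: (i) $\psi$ is Lipschitz and differentiable, and $\nabla\psi(z'+t\xi)\to\nabla\psi(z')$ as $t\to0$ for almost every $\xi\in\mathbb{R}^{n-1}$; (ii) $\partial\Omega\cap U=\{(y,\psi(y)):\ y\in\widehat B_R(z')\}$; (iii) $\Omega\cap U=\{(y,t):\ y\in\widehat B_R(z'),\ a<t<\psi(y)\}$. If $\partial\Omega$ is Lipschitz flat at a point $z\in T(\partial\Omega,x_0)$, then $$S_z(\partial\Omega,x_0)\le 1.$$ -/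

import Mathlib

open MeasureTheory Set Filter Topology
open scoped NNReal ENNReal

namespace SphericalFlatness

/-- The touching set `T(∂Ω, x₀)`: the points of the boundary that realize the distance
from `x₀` to the boundary. -/
def touchingSet {n : ℕ} (Ω : Set (EuclideanSpace ℝ (Fin n))) (x₀ : EuclideanSpace ℝ (Fin n)) :
    Set (EuclideanSpace ℝ (Fin n)) :=
  {z | z ∈ frontier Ω ∧ dist x₀ z = Metric.infDist x₀ (frontier Ω)}

/-- The volume `ω_n` of the unit ball of `ℝⁿ`. -/
noncomputable def unitBallVolume (n : ℕ) : ℝ :=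
  (volume (Metric.ball (0 : EuclideanSpace ℝ (Fin n)) 1)).toReal

/-- The spherical flatness index `S_z(∂Ω, x₀)` in `ℝⁿ`, with `r = |x₀ - z|`. The surface measure
is the `(n-1)`-dimensional Hausdorff measure `μHE[n - 1]`, normalized so that it is Lebesgue measure
on `ℝⁿ⁻¹`. Both lower limits are taken in the extended reals. -/
noncomputable def sphericalFlatnessIndex {n : ℕ} (Ω : Set (EuclideanSpace ℝ (Fin n)))
    (x₀ z : EuclideanSpace ℝ (Fin n)) : EReal :=
  ((2 / ((n : ℝ) * unitBallVolume n * dist x₀ z) : ℝ) : EReal) *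
    liminf (fun R : ℝ =>
      liminf (fun α : EuclideanSpace ℝ (Fin n) =>
        ((∫ x in frontier Ω ∩ Metric.ball z R,
            inner ℝ (α - x) (α - x₀) / ‖x - α‖ ^ n ∂μHE[n - 1] : ℝ) : EReal))
        (𝓝[(closure Ω)ᶜ] z))
      (𝓝[>] (0 : ℝ))

/-- The first `m` coordinates `x'` of a point `x = (x', x_{m+1})` of `ℝᵐ⁺¹`. -/
def base {m : ℕ} (x : EuclideanSpace ℝ (Fin (m + 1))) : EuclideanSpace ℝ (Fin m) :=
  WithLp.toLp 2 (fun i : Fin m => x i.castSucc)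

/-- The last coordinate `x_{m+1}` of a point `x = (x', x_{m+1})` of `ℝᵐ⁺¹`. -/
def height {m : ℕ} (x : EuclideanSpace ℝ (Fin (m + 1))) : ℝ :=
  x (Fin.last m)

/-- The rectangular neighborhood `U_R(a,b)` of `z`: the open ball of radius `R` about `z'` in `ℝᵐ`
times the open interval `(a,b)`. -/
def boxNhd {m : ℕ} (z : EuclideanSpace ℝ (Fin (m + 1))) (R a b : ℝ) :
    Set (EuclideanSpace ℝ (Fin (m + 1))) :=
  {x | base x ∈ Metric.ball (base z) R ∧ height x ∈ Ioo a b}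

/-- Lipschitz flatness of `∂Ω` at `z` in the given coordinates of `ℝᵐ⁺¹ = ℝᵐ × ℝ`. Only the values
of `ψ` on the ball about `z'` matter. -/
def LipschitzFlatInCoordinates {m : ℕ} (Ω : Set (EuclideanSpace ℝ (Fin (m + 1))))
    (z : EuclideanSpace ℝ (Fin (m + 1))) : Prop :=
  ∃ (ψ : EuclideanSpace ℝ (Fin m) → ℝ) (R a b : ℝ),
    0 < R ∧ a < height z ∧ height z < b ∧
    MapsTo ψ (Metric.ball (base z) R) (Ioo a b) ∧
    (∃ K : ℝ≥0, LipschitzOnWith K ψ (Metric.ball (base z) R)) ∧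
    DifferentiableOn ℝ ψ (Metric.ball (base z) R) ∧
    (∀ᵐ ξ : EuclideanSpace ℝ (Fin m),
      Tendsto (fun t : ℝ => gradient ψ (base z + t • ξ)) (𝓝[≠] 0) (𝓝 (gradient ψ (base z)))) ∧
    frontier Ω ∩ boxNhd z R a b =
      {x | base x ∈ Metric.ball (base z) R ∧ height x = ψ (base x)} ∧
    Ω ∩ boxNhd z R a b =
      {x | base x ∈ Metric.ball (base z) R ∧ a < height x ∧ height x < ψ (base x)}

/-- `∂Ω` is Lipschitz flat at `z` if it is so in some orthonormal coordinates, that is, after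
applying some linear isometry `e` of the space (`e` may be the identity). -/
def LipschitzFlat {m : ℕ} (Ω : Set (EuclideanSpace ℝ (Fin (m + 1))))
    (z : EuclideanSpace ℝ (Fin (m + 1))) : Prop :=
  ∃ e : EuclideanSpace ℝ (Fin (m + 1)) ≃ₗᵢ[ℝ] EuclideanSpace ℝ (Fin (m + 1)),
    LipschitzFlatInCoordinates (e '' Ω) (e z)

end SphericalFlatness

/-!
The surface `∂Ω` is looked at from the points `α = z + t ν`, `t ↓ 0`, on the normal line through
`x₀` and `z`. Both lower limits are at most what this choice gives, so an upper bound for the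
surface integral suffices.

* Since `z` is a point of `∂Ω` closest to `x₀`, and the open ball of radius `r = |x₀ - z|` about
  `x₀` lies in `Ω`, the vector `z - x₀` is `r ν` with `ν` the unit normal of the graph at `z` that points
  out of `Ω`, and `z + t ν` lies outside the closure of `Ω` for small `t > 0`.
* With `q = ⟨x - z, ν⟩` the numerator of the integrand is `(r + t) (t - q)`. That `x` lies outside
  the ball about `x₀` gives `-q ≤ |x - z|² / (2 r)`, and differentiability of the graph at `z` gives
  `|x - α|² ≥ (|x - z|² + t²) / 2` near `z`. Hence (`kernel_le`) the integrand is at most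
  `(r + t) t / |x - α|ⁿ + C |x' - z'|²⁻ⁿ`. No such bound for `q` itself is available, and
  none is needed.
* The second term is integrable on the graph, so its contribution vanishes as `R ↓ 0`. The first is
  handled by the substitution `x' = z' + t η` and dominated convergence: the blown-up graph tends to
  its tangent plane and the area density to its value at `z'`, by the convergence of the gradient
  along almost every ray (`tendsto_integral_kernel`). The limit is `r` times half of the total solid
  angle `n ω_n` (`integral_sqrt_div_sqrt_pow`).

Passing from the surface integral to an integral over `ℝⁿ⁻¹` uses only the inequality
`σ(Φ(S)) ≤ ∫_S √(1 + |∇ψ|²)` for the graph map `Φ(y) = (y, ψ(y))`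
(`hausdorffMeasure_graphMap_image_le_lintegral`), because the majorant is nonnegative.
-/

open MeasureTheory Set Filter Topology
open scoped NNReal ENNReal

namespace SphericalFlatness

/-! ### Coordinates of `ℝᵐ⁺¹ = ℝᵐ × ℝ` -/

section Coordinates
variable {m : ℕ}

/-- The point `(y, t)` of `ℝᵐ⁺¹ = ℝᵐ × ℝ`, inverse to the pair of projections `base`, `height`. -/
noncomputable def pair (y : EuclideanSpace ℝ (Fin m)) (t : ℝ) : EuclideanSpace ℝ (Fin (m + 1)) :=
  WithLp.toLp 2 (Fin.snoc (α := fun _ => ℝ) (fun i => y i) t)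

@[simp] lemma base_pair (y : EuclideanSpace ℝ (Fin m)) (t : ℝ) : base (pair y t) = y := by
  ext i; simp [base, pair]

@[simp] lemma height_pair (y : EuclideanSpace ℝ (Fin m)) (t : ℝ) : height (pair y t) = t := by
  simp [height, pair]

lemma ext_base_height {x y : EuclideanSpace ℝ (Fin (m + 1))} (hb : base x = base y)
    (hh : height x = height y) : x = y := by
  ext i
  refine Fin.lastCases hh (fun j => ?_) i
  have := congrArg (fun v : EuclideanSpace ℝ (Fin m) => v j) hb
  simpa [base] using this

@[simp] lemma base_add (x y : EuclideanSpace ℝ (Fin (m + 1))) :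
    base (x + y) = base x + base y := by ext i; simp [base]

@[simp] lemma base_sub (x y : EuclideanSpace ℝ (Fin (m + 1))) :
    base (x - y) = base x - base y := by ext i; simp [base]

@[simp] lemma base_smul (c : ℝ) (x : EuclideanSpace ℝ (Fin (m + 1))) :
    base (c • x) = c • base x := by ext i; simp [base]

@[simp] lemma height_add (x y : EuclideanSpace ℝ (Fin (m + 1))) :
    height (x + y) = height x + height y := by simp [height]

@[simp] lemma height_sub (x y : EuclideanSpace ℝ (Fin (m + 1))) :
    height (x - y) = height x - height y := by simp [height]

@[simp] lemma height_smul (c : ℝ) (x : EuclideanSpace ℝ (Fin (m + 1))) :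
    height (c • x) = c * height x := by simp [height]

lemma inner_eq_base_add_height (x y : EuclideanSpace ℝ (Fin (m + 1))) :
    inner ℝ x y = inner ℝ (base x) (base y) + height x * height y := by
  simp [PiLp.inner_apply, Fin.sum_univ_castSucc, base, height, mul_comm]

lemma norm_sq_eq_base_add_height (x : EuclideanSpace ℝ (Fin (m + 1))) :
    ‖x‖ ^ 2 = ‖base x‖ ^ 2 + height x ^ 2 := by
  rw [← real_inner_self_eq_norm_sq, inner_eq_base_add_height, real_inner_self_eq_norm_sq,
    sq (height x)]

lemma norm_base_le (x : EuclideanSpace ℝ (Fin (m + 1))) : ‖base x‖ ≤ ‖x‖ := by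
  rw [← sq_le_sq₀ (norm_nonneg _) (norm_nonneg _), norm_sq_eq_base_add_height]
  nlinarith [sq_nonneg (height x)]

lemma continuous_base : Continuous (base : EuclideanSpace ℝ (Fin (m + 1)) → _) := by
  unfold base; fun_prop

lemma continuous_height : Continuous (height : EuclideanSpace ℝ (Fin (m + 1)) → ℝ) := by
  unfold height; fun_prop

lemma _root_.Continuous.pair {X : Type*} [TopologicalSpace X] {f : X → EuclideanSpace ℝ (Fin m)}
    {g : X → ℝ} (hf : Continuous f) (hg : Continuous g) : Continuous fun x => pair (f x) (g x) := by
  unfold SphericalFlatness.pair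
  refine (PiLp.continuous_toLp 2 _).comp (continuous_pi fun i => ?_)
  refine Fin.lastCases ?_ (fun j => ?_) i
  · simpa using hg
  · simp; fun_prop

end Coordinates

/-! ### The shear of a linear graph -/

section Shear
variable {m : ℕ}

/-- The linear map `y ↦ y + c ⟨p, y⟩ p`, `c = 1 / (1 + √(1 + |p|²))`: the square root of
`1 + p pᵀ`, so that it turns the metric of the graph of `⟨p, ·⟩` into the Euclidean one. -/
noncomputable def graphShear (p : EuclideanSpace ℝ (Fin m)) :
    EuclideanSpace ℝ (Fin m) →ₗ[ℝ] EuclideanSpace ℝ (Fin m) :=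
  LinearMap.transvection (innerₛₗ ℝ p) ((1 / (1 + √(1 + ‖p‖ ^ 2))) • p)

lemma graphShear_apply (p y : EuclideanSpace ℝ (Fin m)) :
    graphShear p y = y + inner ℝ p y • (1 / (1 + √(1 + ‖p‖ ^ 2))) • p := by
  simp [graphShear, LinearMap.transvection.apply]

lemma det_graphShear (p : EuclideanSpace ℝ (Fin m)) :
    LinearMap.det (graphShear p) = √(1 + ‖p‖ ^ 2) := by
  rw [graphShear, LinearMap.transvection.det]
  simp only [innerₛₗ_apply_apply, inner_smul_right, real_inner_self_eq_norm_sq]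
  have h := Real.sq_sqrt (show 0 ≤ 1 + ‖p‖ ^ 2 by positivity)
  have h0 := Real.sqrt_nonneg (1 + ‖p‖ ^ 2)
  field_simp
  linarith

lemma norm_sq_graphShear (p y : EuclideanSpace ℝ (Fin m)) :
    ‖graphShear p y‖ ^ 2 = ‖y‖ ^ 2 + (inner ℝ p y) ^ 2 := by
  rw [graphShear_apply, norm_add_sq_real, norm_smul, norm_smul, inner_smul_right, inner_smul_right,
    real_inner_comm p y, mul_pow, mul_pow]
  have h := Real.sq_sqrt (show 0 ≤ 1 + ‖p‖ ^ 2 by positivity)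
  have h0 := Real.sqrt_nonneg (1 + ‖p‖ ^ 2)
  have hp : ‖p‖ ^ 2 = √(1 + ‖p‖ ^ 2) ^ 2 - 1 := by linarith
  rw [hp, Real.norm_eq_abs, Real.norm_eq_abs, sq_abs, sq_abs, ← hp]
  set s := √(1 + ‖p‖ ^ 2)
  field_simp
  linear_combination (-(inner ℝ p y) ^ 2) * h

lemma norm_graphShear_eq_norm_pair (p y : EuclideanSpace ℝ (Fin m)) :
    ‖graphShear p y‖ = ‖pair y (inner ℝ p y)‖ := by
  rw [← sq_eq_sq₀ (norm_nonneg _) (norm_nonneg _), norm_sq_graphShear, norm_sq_eq_base_add_height]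
  simp

end Shear

/-! ### The area inequality for graphs -/

section Area
variable {m : ℕ}

/-- The graph map `y ↦ (y, ψ y)`. -/
noncomputable def graphMap (ψ : EuclideanSpace ℝ (Fin m) → ℝ) (y : EuclideanSpace ℝ (Fin m)) :
    EuclideanSpace ℝ (Fin (m + 1)) :=
  pair y (ψ y)

/-- The area density `√(1 + |∇ψ|²)` of the graph of `ψ`. -/
noncomputable def areaDensity (ψ : EuclideanSpace ℝ (Fin m) → ℝ) (y : EuclideanSpace ℝ (Fin m)) :
    ℝ :=
  √(1 + ‖gradient ψ y‖ ^ 2)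

lemma areaDensity_nonneg (ψ : EuclideanSpace ℝ (Fin m) → ℝ) (y : EuclideanSpace ℝ (Fin m)) :
    0 ≤ areaDensity ψ y := Real.sqrt_nonneg _

lemma measurable_gradient (ψ : EuclideanSpace ℝ (Fin m) → ℝ) : Measurable (gradient ψ) :=
  (InnerProductSpace.toDual ℝ (EuclideanSpace ℝ (Fin m))).symm.continuous.measurable.comp
    (measurable_fderiv ℝ ψ)

lemma measurable_areaDensity (ψ : EuclideanSpace ℝ (Fin m) → ℝ) : Measurable (areaDensity ψ) :=
  Real.continuous_sqrt.measurable.comp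
    (measurable_const.add ((measurable_gradient ψ).norm.pow_const 2))

lemma sqrt_one_add_norm_sq_le_add {E : Type*} [SeminormedAddCommGroup E] {p q : E} {δ : ℝ}
    (h : ‖p - q‖ ≤ δ) : √(1 + ‖q‖ ^ 2) ≤ √(1 + ‖p‖ ^ 2) + δ := by
  have hδ : 0 ≤ δ := (norm_nonneg _).trans h
  have hq : ‖q‖ ≤ ‖p‖ + δ := by
    have := norm_sub_norm_le q p
    rw [norm_sub_rev] at this
    linarith
  have hs := Real.sq_sqrt (show 0 ≤ 1 + ‖p‖ ^ 2 by positivity)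
  have hps : ‖p‖ ≤ √(1 + ‖p‖ ^ 2) := Real.le_sqrt_of_sq_le (by linarith)
  refine Real.sqrt_le_iff.2 ⟨by positivity, ?_⟩
  nlinarith [norm_nonneg q, norm_nonneg p, mul_le_mul_of_nonneg_right hps hδ]

/-- Where `ψ` is `δ`-close to the linear form `⟨p, ·⟩`, the graph map factors through the shear of
`p` followed by a `(1 + δ)`-Lipschitz map, and the shear has determinant `√(1 + |p|²)`. -/
lemma hausdorffMeasure_graphMap_image_le {ψ : EuclideanSpace ℝ (Fin m) → ℝ}
    {p : EuclideanSpace ℝ (Fin m)} {T : Set (EuclideanSpace ℝ (Fin m))} {δ : ℝ≥0}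
    (h : ApproximatesLinearOn ψ (innerSL ℝ p) T δ) :
    μHE[m] (graphMap ψ '' T) ≤
      (1 + δ : ℝ≥0∞) ^ m * (ENNReal.ofReal √(1 + ‖p‖ ^ 2) * volume T) := by
  set A := graphShear p
  have hA : Function.Injective A := by
    rw [← LinearMap.ker_eq_bot, LinearMap.ker_eq_bot']
    intro y hy
    have := norm_sq_graphShear p y
    rw [show graphShear p y = 0 from hy] at this
    have h2 : ‖y‖ ^ 2 = 0 := by
      simp at this
      nlinarith [sq_nonneg ‖y‖, sq_nonneg (inner ℝ p y)]
    simpa using h2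
  have hinv : ∀ y, Function.invFun A (A y) = y := Function.leftInverse_invFun hA
  have hlip : LipschitzOnWith (1 + δ) (graphMap ψ ∘ Function.invFun A) (A '' T) := by
    refine LipschitzOnWith.of_dist_le_mul ?_
    rintro _ ⟨a, ha, rfl⟩ _ ⟨b, hb, rfl⟩
    simp only [Function.comp_apply, hinv, dist_eq_norm]
    have hdec : graphMap ψ a - graphMap ψ b = pair (a - b) (inner ℝ p (a - b)) +
        pair 0 (ψ a - ψ b - inner ℝ p (a - b)) :=
      ext_base_height (by simp [graphMap]) (by simp [graphMap])
    have h1 : ‖pair (0 : EuclideanSpace ℝ (Fin m)) (ψ a - ψ b - inner ℝ p (a - b))‖ ≤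
        δ * ‖a - b‖ := by
      have h2 := h a ha b hb
      have h3 : ‖pair (0 : EuclideanSpace ℝ (Fin m)) (ψ a - ψ b - inner ℝ p (a - b))‖ =
          ‖ψ a - ψ b - inner ℝ p (a - b)‖ := by
        rw [← sq_eq_sq₀ (norm_nonneg _) (norm_nonneg _), norm_sq_eq_base_add_height]
        simp
      rw [h3]
      simpa using h2
    have h4 : ‖a - b‖ ≤ ‖A (a - b)‖ := by
      rw [norm_graphShear_eq_norm_pair]
      simpa using norm_base_le (pair (a - b) (inner ℝ p (a - b)))
    rw [hdec, ← map_sub]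
    refine (norm_add_le _ _).trans ?_
    rw [← norm_graphShear_eq_norm_pair]
    push_cast
    have := mul_le_mul_of_nonneg_left h4 δ.coe_nonneg
    change ‖A (a - b)‖ + _ ≤ _
    linarith
  have himg : graphMap ψ '' T = (graphMap ψ ∘ Function.invFun A) '' (A '' T) := by
    rw [image_comp, ← image_comp (Function.invFun A) A]
    congr 1
    simp [hinv]
  have h5 : μHE[m] (graphMap ψ '' T) ≤ (1 + δ : ℝ≥0∞) ^ m * μHE[m] (A '' T) := by
    rw [himg, Measure.euclideanHausdorffMeasure_def, Measure.euclideanHausdorffMeasure_def,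
      Measure.smul_apply, Measure.smul_apply, mul_smul_comm]
    have := hlip.hausdorffMeasure_image_le (d := m) (by positivity)
    refine smul_le_smul_of_nonneg_left (this.trans_eq ?_) (by positivity)
    simp
  refine h5.trans_eq ?_
  rw [EuclideanSpace.euclideanHausdorffMeasure_eq_volume, Measure.addHaar_image_linearMap,
    det_graphShear, abs_of_nonneg (Real.sqrt_nonneg _)]

/-- The upper half of the area formula for graphs: cut `S` into countably many pieces on which `ψ`
is `δ`-close to a linear form, and let `δ → 0`. -/
lemma hausdorffMeasure_graphMap_image_le_lintegral (hm : 1 ≤ m)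
    {ψ : EuclideanSpace ℝ (Fin m) → ℝ} {S : Set (EuclideanSpace ℝ (Fin m))}
    (hS : MeasurableSet S) (hSfin : volume S ≠ ∞) (hψ : ∀ y ∈ S, DifferentiableAt ℝ ψ y) :
    μHE[m] (graphMap ψ '' S) ≤ ∫⁻ y in S, ENNReal.ofReal (areaDensity ψ y) := by
  set I := ∫⁻ y in S, ENNReal.ofReal (areaDensity ψ y)
  have hgrad : ∀ y ∈ S, HasFDerivWithinAt ψ (innerSL ℝ (gradient ψ y)) S y := by
    intro y hy
    have := (hψ y hy).hasGradientAt.hasFDerivAt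
    exact this.hasFDerivWithinAt
  have key : ∀ δ : ℝ≥0, 0 < δ →
      μHE[m] (graphMap ψ '' S) ≤ (1 + δ : ℝ≥0∞) ^ m * (I + δ * volume S) := by
    intro δ hδ
    obtain ⟨t, L, hdisj, hmeas, hcov, happ, -⟩ :=
      exists_partition_approximatesLinearOn_of_hasFDerivWithinAt ψ S
        (fun y => innerSL ℝ (gradient ψ y)) hgrad (fun _ => δ) (fun _ => hδ.ne')
    let p : ℕ → EuclideanSpace ℝ (Fin m) := fun n =>
      (InnerProductSpace.toDual ℝ (EuclideanSpace ℝ (Fin m))).symm (L n)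
    have hL : ∀ n, L n = innerSL ℝ (p n) := by
      intro n
      ext y
      simp [p]
    -- The density-point lemma is stated for self-maps: apply it to `ψ • v` with `v` a unit vector.
    let v : EuclideanSpace ℝ (Fin m) := EuclideanSpace.single ⟨0, hm⟩ 1
    have hv : ‖v‖ = 1 := by simp [v]
    have hclose : ∀ n, ∀ᵐ y ∂(volume.restrict (S ∩ t n)), ‖gradient ψ y - p n‖ ≤ δ := by
      intro n
      have happ' : ApproximatesLinearOn (fun y => ψ y • v) ((innerSL ℝ (p n)).smulRight v)
          (S ∩ t n) δ := by
        intro a ha b hb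
        have := happ n a ha b hb
        rw [hL] at this
        have heq : ψ a • v - ψ b • v - ((innerSL ℝ (p n)).smulRight v) (a - b) =
            (ψ a - ψ b - innerSL ℝ (p n) (a - b)) • v := by
          simp [sub_smul]
        rw [heq, norm_smul, hv, mul_one]
        exact this
      have := happ'.norm_fderiv_sub_le volume (hS.inter (hmeas n))
        (fun y => (innerSL ℝ (gradient ψ y)).smulRight v)
        (fun y hy => ((hgrad y hy.1).mono inter_subset_left).smul_const v)
      filter_upwards [this] with y hy
      have heq : (innerSL ℝ (gradient ψ y)).smulRight v - (innerSL ℝ (p n)).smulRight v =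
          (innerSL ℝ (gradient ψ y - p n)).smulRight v := by
        ext; simp [sub_smul]
      have h2 : ‖(innerSL ℝ (gradient ψ y)).smulRight v - (innerSL ℝ (p n)).smulRight v‖ ≤ δ := hy
      rwa [heq, ContinuousLinearMap.norm_smulRight_apply, hv, mul_one, innerSL_apply_norm] at h2
    have hpiece : ∀ n, μHE[m] (graphMap ψ '' (S ∩ t n)) ≤
        (1 + δ : ℝ≥0∞) ^ m * ∫⁻ y in S ∩ t n, (ENNReal.ofReal (areaDensity ψ y) + δ) := by
      intro n
      have h1 := happ n
      rw [hL] at h1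
      refine (hausdorffMeasure_graphMap_image_le h1).trans ?_
      gcongr
      rw [← setLIntegral_const]
      refine lintegral_mono_ae ?_
      filter_upwards [hclose n] with y hy
      rw [← ENNReal.ofReal_coe_nnreal, ← ENNReal.ofReal_add (areaDensity_nonneg _ _) δ.coe_nonneg]
      exact ENNReal.ofReal_le_ofReal (sqrt_one_add_norm_sq_le_add hy)
    have hSU : S = ⋃ n, S ∩ t n := by
      rw [← inter_iUnion]; exact (inter_eq_left.2 hcov).symm
    calc μHE[m] (graphMap ψ '' S) = μHE[m] (⋃ n, graphMap ψ '' (S ∩ t n)) := by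
          rw [← image_iUnion, ← hSU]
      _ ≤ ∑' n, μHE[m] (graphMap ψ '' (S ∩ t n)) := measure_iUnion_le _
      _ ≤ ∑' n, (1 + δ : ℝ≥0∞) ^ m * ∫⁻ y in S ∩ t n, (ENNReal.ofReal (areaDensity ψ y) + δ) :=
          ENNReal.tsum_le_tsum hpiece
      _ = (1 + δ : ℝ≥0∞) ^ m * ∫⁻ y in S, (ENNReal.ofReal (areaDensity ψ y) + δ) := by
          rw [ENNReal.tsum_mul_left]
          conv_rhs => rw [hSU]
          rw [lintegral_iUnion (fun n => hS.inter (hmeas n))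
            (fun i j hij => (hdisj hij).mono inter_subset_right inter_subset_right)]
      _ = (1 + δ : ℝ≥0∞) ^ m * (I + δ * volume S) := by
          rw [lintegral_add_right _ measurable_const, setLIntegral_const]
  have hlim : Tendsto (fun δ : ℝ≥0 => (1 + δ : ℝ≥0∞) ^ m * (I + δ * volume S)) (𝓝[>] 0)
      (𝓝 ((1 + (0 : ℝ≥0)) ^ m * (I + (0 : ℝ≥0) * volume S))) := by
    have hc : Tendsto (fun δ : ℝ≥0 => (δ : ℝ≥0∞)) (𝓝[>] 0) (𝓝 ((0 : ℝ≥0) : ℝ≥0∞)) :=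
      (ENNReal.continuous_coe.tendsto 0).mono_left nhdsWithin_le_nhds
    refine ENNReal.Tendsto.mul (((ENNReal.continuous_pow m).tendsto _).comp (hc.const_add 1))
      (Or.inl (by simp))
      ((ENNReal.Tendsto.mul_const hc (Or.inr hSfin)).const_add I) (Or.inr (by simp))
  simp only [ENNReal.coe_zero, add_zero, one_pow, zero_mul, one_mul] at hlim
  exact ge_of_tendsto hlim (by filter_upwards [self_mem_nhdsWithin] with δ hδ using key δ hδ)

/-- The same bound for integrals: on the image of `S` the Hausdorff measure is dominated by the
push-forward of the area density. -/
lemma lintegral_graphMap_image_le (hm : 1 ≤ m)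
    {ψ : EuclideanSpace ℝ (Fin m) → ℝ} (hc : Continuous ψ) {S : Set (EuclideanSpace ℝ (Fin m))}
    (hS : MeasurableSet S) (hSfin : volume S ≠ ∞) (hψ : ∀ y ∈ S, DifferentiableAt ℝ ψ y)
    {f : EuclideanSpace ℝ (Fin (m + 1)) → ℝ≥0∞} (hf : Measurable f) :
    ∫⁻ x in graphMap ψ '' S, f x ∂μHE[m] ≤
      ∫⁻ y in S, ENNReal.ofReal (areaDensity ψ y) * f (graphMap ψ y) := by
  have hΦ : Measurable (graphMap ψ) := (continuous_id.pair hc).measurable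
  have hJ : Measurable fun y => ENNReal.ofReal (areaDensity ψ y) :=
    (measurable_areaDensity ψ).ennreal_ofReal
  have hle : (μHE[m]).restrict (graphMap ψ '' S) ≤
      ((volume.restrict S).withDensity fun y => ENNReal.ofReal (areaDensity ψ y)).map
        (graphMap ψ) := by
    refine Measure.le_iff.2 fun T hT => ?_
    rw [Measure.restrict_apply hT, Measure.map_apply hΦ hT, withDensity_apply _ (hΦ hT),
      Measure.restrict_restrict (hΦ hT), inter_comm T, ← image_inter_preimage, inter_comm S]
    exact hausdorffMeasure_graphMap_image_le_lintegral hm ((hΦ hT).inter hS)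
      (ne_top_of_le_ne_top hSfin (measure_mono inter_subset_right)) fun y hy => hψ y hy.2
  refine (lintegral_mono' hle le_rfl).trans_eq ?_
  rw [lintegral_map hf hΦ]
  exact lintegral_withDensity_eq_lintegral_mul _ hJ (hf.comp hΦ)

end Area

/-! ### The solid angle of a hyperplane -/

section SolidAngle
variable {m : ℕ}

lemma integrable_exp_neg_mul_norm_sq {b : ℝ} (hb : 0 < b) :
    Integrable fun w : EuclideanSpace ℝ (Fin m) => Real.exp (-b * ‖w‖ ^ 2) := by
  refine .of_integral_ne_zero ?_
  rw [GaussianFourier.integral_rexp_neg_mul_sq_norm hb]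
  positivity

/-- The subordination identity `Γ(a) (1 + |w|²)^{-a} = ∫₀^∞ s^{a-1} e^{-(1 + |w|²) s} ds` reduces
the integral to a Gaussian one; the exponent `a = (m + 1) / 2` makes the remaining integral
`Γ(1/2) = √π`. -/
lemma integral_one_add_norm_sq_rpow :
    ∫ w : EuclideanSpace ℝ (Fin m), (1 / (1 + ‖w‖ ^ 2)) ^ (((m : ℝ) + 1) / 2) =
      Real.pi ^ (((m : ℝ) + 1) / 2) / Real.Gamma (((m : ℝ) + 1) / 2) := by
  set a : ℝ := ((m : ℝ) + 1) / 2 with ha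
  have ha0 : 0 < a := by positivity
  have hΓ : 0 < Real.Gamma a := Real.Gamma_pos_of_pos ha0
  let F : ℝ → EuclideanSpace ℝ (Fin m) → ℝ := fun s w =>
    s ^ (a - 1) * Real.exp (-((1 + ‖w‖ ^ 2) * s))
  have hF : ∀ s w, F s w = s ^ (a - 1) * Real.exp (-s) * Real.exp (-s * ‖w‖ ^ 2) := by
    intro s w
    simp only [F]
    rw [mul_assoc, ← Real.exp_add]
    congr 2; ring
  have hinner : ∀ s ∈ Ioi (0 : ℝ), ∫ w, F s w =
      Real.pi ^ ((m : ℝ) / 2) * (s ^ ((1 / 2 : ℝ) - 1) * Real.exp (-(1 * s))) := by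
    intro s hs
    have hs : 0 < s := hs
    simp_rw [hF]
    rw [integral_const_mul, GaussianFourier.integral_rexp_neg_mul_sq_norm hs,
      finrank_euclideanSpace_fin, Real.div_rpow Real.pi_pos.le hs.le, one_mul]
    have : s ^ (a - 1) / s ^ ((m : ℝ) / 2) = s ^ ((1 / 2 : ℝ) - 1) := by
      rw [← Real.rpow_sub hs]
      congr 1; rw [ha]; ring
    rw [← this]
    ring
  have hΓint := Real.integral_rpow_mul_exp_neg_mul_Ioi (a := 1 / 2) (r := 1) (by norm_num) one_pos
  have hΓI : IntegrableOn (fun s : ℝ => s ^ ((1 / 2 : ℝ) - 1) * Real.exp (-(1 * s))) (Ioi 0) := by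
    refine .of_integral_ne_zero ?_
    rw [hΓint, Real.Gamma_one_half_eq]
    positivity
  have hint : Integrable (Function.uncurry F) ((volume.restrict (Ioi (0 : ℝ))).prod volume) := by
    rw [integrable_prod_iff]
    · constructor
      · filter_upwards [ae_restrict_mem measurableSet_Ioi] with s hs
        simp only [Function.uncurry_apply_pair, hF]
        exact (integrable_exp_neg_mul_norm_sq hs).const_mul _
      · refine (hΓI.const_mul (Real.pi ^ ((m : ℝ) / 2))).congr ?_
        filter_upwards [ae_restrict_mem measurableSet_Ioi] with s hs
        rw [← hinner s hs]
        refine integral_congr_ae (Eventually.of_forall fun w => ?_)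
        have hs : 0 < s := hs
        have : 0 ≤ F s w := by simp only [F]; positivity
        simp [abs_of_nonneg this]
    · apply Measurable.aestronglyMeasurable
      simp only [F, Function.uncurry_def]
      fun_prop
  have hswap := integral_integral_swap hint
  rw [setIntegral_congr_fun measurableSet_Ioi hinner, integral_const_mul, hΓint,
    Real.Gamma_one_half_eq] at hswap
  have houter : ∀ w : EuclideanSpace ℝ (Fin m), ∫ s in Ioi (0 : ℝ), F s w =
      (1 / (1 + ‖w‖ ^ 2)) ^ a * Real.Gamma a := fun w =>
    Real.integral_rpow_mul_exp_neg_mul_Ioi ha0 (by positivity)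
  simp_rw [houter] at hswap
  rw [integral_mul_const] at hswap
  rw [eq_div_iff hΓ.ne', ← hswap, Real.sqrt_eq_rpow]
  simp only [div_one, Real.one_rpow, one_mul]
  rw [← Real.rpow_add Real.pi_pos]
  congr 1; rw [ha]; ring

lemma one_div_rpow_half_eq {m : ℕ} {x : ℝ} (hx : 0 ≤ x) :
    (1 / x) ^ (((m : ℝ) + 1) / 2) = 1 / √x ^ (m + 1) := by
  rw [Real.div_rpow zero_le_one hx, Real.one_rpow, Real.sqrt_eq_rpow, ← Real.rpow_natCast,
    ← Real.rpow_mul hx]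
  congr 2; push_cast; ring

lemma unitBallVolume_pos (n : ℕ) : 0 < unitBallVolume n :=
  ENNReal.toReal_pos (Metric.measure_ball_pos _ _ one_pos).ne' measure_ball_lt_top.ne

/-- A hyperplane at distance one fills half of the total solid angle `(m + 1) ω_{m+1}`. -/
lemma integral_one_div_sqrt_pow :
    ∫ w : EuclideanSpace ℝ (Fin m), 1 / √(1 + ‖w‖ ^ 2) ^ (m + 1) =
      ((m + 1 : ℕ) : ℝ) * unitBallVolume (m + 1) / 2 := by
  have h1 : ∀ w : EuclideanSpace ℝ (Fin m), 1 / √(1 + ‖w‖ ^ 2) ^ (m + 1) =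
      (1 / (1 + ‖w‖ ^ 2)) ^ (((m : ℝ) + 1) / 2) := fun w =>
    (one_div_rpow_half_eq (by positivity)).symm
  simp_rw [h1]
  rw [integral_one_add_norm_sq_rpow, unitBallVolume, EuclideanSpace.volume_ball]
  have h2 : (((m + 1 : ℕ) : ℝ) / 2 + 1) = ((m : ℝ) + 1) / 2 + 1 := by push_cast; ring
  have h3 : √Real.pi ^ (m + 1) = Real.pi ^ (((m : ℝ) + 1) / 2) := by
    rw [Real.sqrt_eq_rpow, ← Real.rpow_natCast, ← Real.rpow_mul Real.pi_pos.le]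
    congr 1; push_cast; ring
  have hΓ : 0 < Real.Gamma (((m : ℝ) + 1) / 2) := Real.Gamma_pos_of_pos (by positivity)
  simp only [ENNReal.ofReal_one, one_pow, one_mul, Fintype.card_fin]
  rw [h2, h3, Real.Gamma_add_one (by positivity), ENNReal.toReal_ofReal (by positivity)]
  push_cast
  field_simp

lemma integrable_one_div_sqrt_pow :
    Integrable fun w : EuclideanSpace ℝ (Fin m) => 1 / √(1 + ‖w‖ ^ 2) ^ (m + 1) := by
  refine .of_integral_ne_zero ?_
  rw [integral_one_div_sqrt_pow]
  have := unitBallVolume_pos (m + 1)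
  positivity

/-- The solid angle of a hyperplane, written as a graph of slope `p`. -/
lemma integral_sqrt_div_sqrt_pow (p : EuclideanSpace ℝ (Fin m)) :
    ∫ η : EuclideanSpace ℝ (Fin m),
        √(1 + ‖p‖ ^ 2) / √(1 + (‖η‖ ^ 2 + inner ℝ p η ^ 2)) ^ (m + 1) =
      ((m + 1 : ℕ) : ℝ) * unitBallVolume (m + 1) / 2 := by
  have hdet : LinearMap.det (graphShear p) ≠ 0 := by
    rw [det_graphShear]; positivity
  have hinj : Function.Injective (graphShear p) :=
    (LinearMap.equivOfDetNeZero (graphShear p) hdet).injective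
  have hsurj : Function.Surjective (graphShear p) :=
    (LinearMap.equivOfDetNeZero (graphShear p) hdet).surjective
  have := integral_image_eq_integral_abs_det_fderiv_smul volume MeasurableSet.univ
    (f := graphShear p) (f' := fun _ => LinearMap.toContinuousLinearMap (graphShear p))
    (fun x _ => (LinearMap.toContinuousLinearMap (graphShear p)).hasFDerivWithinAt)
    hinj.injOn (fun w => 1 / √(1 + ‖w‖ ^ 2) ^ (m + 1))
  rw [image_univ, hsurj.range_eq, setIntegral_univ, setIntegral_univ,
    integral_one_div_sqrt_pow] at this
  rw [this]
  refine integral_congr_ae (Eventually.of_forall fun η => ?_)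
  have h : (LinearMap.toContinuousLinearMap (graphShear p)).det = √(1 + ‖p‖ ^ 2) := by
    rw [← det_graphShear]; rfl
  simp only [h, abs_of_nonneg (Real.sqrt_nonneg _), smul_eq_mul, norm_sq_graphShear]
  rw [mul_one_div]

end SolidAngle

/-! ### The normal at a touching point -/

section Normal
variable {m : ℕ}

/-- The upward unit normal of a graph of slope `p`. -/
noncomputable def unitNormal (p : EuclideanSpace ℝ (Fin m)) : EuclideanSpace ℝ (Fin (m + 1)) :=
  (√(1 + ‖p‖ ^ 2))⁻¹ • pair (-p) 1

@[simp] lemma base_unitNormal (p : EuclideanSpace ℝ (Fin m)) :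
    base (unitNormal p) = -((√(1 + ‖p‖ ^ 2))⁻¹ • p) := by simp [unitNormal]

@[simp] lemma height_unitNormal (p : EuclideanSpace ℝ (Fin m)) :
    height (unitNormal p) = (√(1 + ‖p‖ ^ 2))⁻¹ := by simp [unitNormal]

lemma norm_pair_neg_one (p : EuclideanSpace ℝ (Fin m)) : ‖pair (-p) 1‖ = √(1 + ‖p‖ ^ 2) := by
  rw [← sq_eq_sq₀ (norm_nonneg _) (Real.sqrt_nonneg _), norm_sq_eq_base_add_height,
    Real.sq_sqrt (by positivity)]
  simp [add_comm]

lemma norm_unitNormal (p : EuclideanSpace ℝ (Fin m)) : ‖unitNormal p‖ = 1 := by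
  have : 0 < √(1 + ‖p‖ ^ 2) := by positivity
  rw [unitNormal, norm_smul, norm_pair_neg_one, Real.norm_eq_abs, abs_of_pos (by positivity)]
  field_simp

lemma inner_unitNormal (p : EuclideanSpace ℝ (Fin m)) (x : EuclideanSpace ℝ (Fin (m + 1))) :
    inner ℝ x (unitNormal p) = (√(1 + ‖p‖ ^ 2))⁻¹ * (height x - inner ℝ p (base x)) := by
  rw [inner_eq_base_add_height, base_unitNormal, height_unitNormal, inner_neg_right,
    inner_smul_right, real_inner_comm]
  ring

lemma inner_graphMap_sub_isLittleO {ψ : EuclideanSpace ℝ (Fin m) → ℝ} {c : EuclideanSpace ℝ (Fin m)}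
    (h : DifferentiableAt ℝ ψ c) :
    (fun y => inner ℝ (graphMap ψ y - graphMap ψ c) (unitNormal (gradient ψ c)))
      =o[𝓝 c] fun y => y - c := by
  have h1 := h.hasGradientAt.hasFDerivAt.isLittleO
  refine (h1.const_mul_left (√(1 + ‖gradient ψ c‖ ^ 2))⁻¹).congr_left fun y => ?_
  rw [inner_unitNormal]
  simp [graphMap]

/-- A ball without boundary points around a point of an open set lies in the set. -/
lemma ball_infDist_frontier_subset {E : Type*} [NormedAddCommGroup E] [NormedSpace ℝ E]
    {Ω : Set E} (hΩ : IsOpen Ω) {x₀ : E} (hx₀ : x₀ ∈ Ω) :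
    Metric.ball x₀ (Metric.infDist x₀ (frontier Ω)) ⊆ Ω := by
  rcases (Metric.infDist_nonneg : 0 ≤ Metric.infDist x₀ (frontier Ω)).eq_or_lt with h0 | hpos
  · rw [← h0]; simp
  refine (convex_ball _ _).isPreconnected.subset_left_of_subset_union hΩ
    (isClosed_closure (s := Ω)).isOpen_compl
    (disjoint_compl_right_iff_subset.2 subset_closure) (fun x hx => ?_)
    ⟨x₀, Metric.mem_ball_self hpos, hx₀⟩
  by_contra hcon
  simp only [mem_union, mem_compl_iff, not_or, not_not] at hcon
  have hxf : x ∈ frontier Ω := by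
    rw [hΩ.frontier_eq]; exact ⟨hcon.2, hcon.1⟩
  have := Metric.infDist_le_dist_of_mem (x := x₀) hxf
  rw [Metric.mem_ball, dist_comm] at hx
  linarith

/-- At a point of a graph that is closest to `x₀`, the vector from `x₀` is normal to the graph. -/
lemma sub_eq_smul_of_isLocalMin {ψ : EuclideanSpace ℝ (Fin m) → ℝ}
    {c : EuclideanSpace ℝ (Fin m)} {x₀ : EuclideanSpace ℝ (Fin (m + 1))}
    (hψ : DifferentiableAt ℝ ψ c)
    (hmin : IsLocalMin (fun y => ‖graphMap ψ y - x₀‖ ^ 2) c) :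
    graphMap ψ c - x₀ = height (graphMap ψ c - x₀) • pair (-gradient ψ c) 1 := by
  have h1 : HasFDerivAt (fun y => y - base x₀) (ContinuousLinearMap.id ℝ _) c :=
    (hasFDerivAt_id c).sub_const _
  have h2 := h1.norm_sq
  have h3 := (hψ.hasGradientAt.hasFDerivAt.sub_const (height x₀)).pow 2
  have h4 := h2.add h3
  have heq : (fun y => ‖graphMap ψ y - x₀‖ ^ 2) =
      (fun y => ‖y - base x₀‖ ^ 2) + fun y => (ψ y - height x₀) ^ 2 := by
    ext y
    rw [norm_sq_eq_base_add_height]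
    simp [graphMap]
  rw [heq] at hmin
  have h5 := hmin.hasFDerivAt_eq_zero h4
  refine ext_base_height ?_ (by simp)
  refine ext_inner_right ℝ fun v => ?_
  have h6 := congrArg (fun L => L v) h5
  simp at h6
  simp [graphMap, inner_smul_left, inner_sub_left]
  linarith

/-- Moving from a point of a graph along the upward normal leads above the graph. -/
lemma eventually_lt_height_add_smul_unitNormal {ψ : EuclideanSpace ℝ (Fin m) → ℝ}
    {c : EuclideanSpace ℝ (Fin m)} (hψ : DifferentiableAt ℝ ψ c) :
    ∀ᶠ t : ℝ in 𝓝[>] 0, ψ (base (graphMap ψ c + t • unitNormal (gradient ψ c))) <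
      height (graphMap ψ c + t • unitNormal (gradient ψ c)) := by
  set p := gradient ψ c
  set s := √(1 + ‖p‖ ^ 2) with hs
  have hs0 : 0 < s := by positivity
  let g : ℝ → ℝ := fun t => ψ c + t * s⁻¹ - ψ (c + t • (-(s⁻¹ • p)))
  have hline : HasDerivAt (fun t : ℝ => c + t • (-(s⁻¹ • p))) (-(s⁻¹ • p)) 0 := by
    simpa using ((hasDerivAt_id (0 : ℝ)).smul_const (-(s⁻¹ • p))).const_add c
  have hψ' : HasFDerivAt ψ (innerSL ℝ p) (c + (0 : ℝ) • (-(s⁻¹ • p))) := by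
    rw [zero_smul, add_zero]
    exact hψ.hasGradientAt.hasFDerivAt
  have hg : HasDerivAt g (s⁻¹ + s⁻¹ * ‖p‖ ^ 2) 0 := by
    have h1 := hψ'.comp_hasDerivAt 0 hline
    have h2 := (((hasDerivAt_id (0 : ℝ)).mul_const s⁻¹).const_add (ψ c)).sub h1
    convert! h2 using 1
    simp [inner_smul_right]
  have hpos : 0 < s⁻¹ + s⁻¹ * ‖p‖ ^ 2 := by positivity
  have h0 : g 0 = 0 := by simp [g]
  have hslope := (hasDerivAt_iff_tendsto_slope.1 hg).eventually (lt_mem_nhds hpos)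
  have hslope' := hslope.filter_mono (nhdsWithin_mono 0 (fun t (ht : 0 < t) => ht.ne'))
  filter_upwards [hslope', self_mem_nhdsWithin] with t ht htpos
  have htpos : 0 < t := htpos
  rw [slope_def_field, h0, sub_zero, sub_zero] at ht
  have : 0 < g t := by
    have := mul_pos ht htpos
    rwa [div_mul_cancel₀ _ htpos.ne'] at this
  simp only [base_add, base_smul, base_unitNormal, height_add, height_smul, height_unitNormal,
    graphMap, base_pair, height_pair]
  exact sub_pos.1 this

end Normal

/-! ### Blow-up of the kernel at a point of a graph -/

section Blowup

lemma half_norm_sq_add_sq_le {E : Type*} [NormedAddCommGroup E] [InnerProductSpace ℝ E] {u ν : E}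
    {t : ℝ} (ht : 0 ≤ t) (hν : ‖ν‖ = 1) (h : |inner ℝ u ν| ≤ ‖u‖ / 2) :
    (‖u‖ ^ 2 + t ^ 2) / 2 ≤ ‖u - t • ν‖ ^ 2 := by
  rw [norm_sub_sq_real, inner_smul_right, norm_smul, hν, Real.norm_eq_abs, mul_one, sq_abs]
  have := mul_le_mul_of_nonneg_left (le_of_abs_le h) ht
  nlinarith [sq_nonneg (‖u‖ - t), sq_nonneg ‖u‖]

lemma sqrt_le_sqrt_two_mul_norm_sub {E : Type*} [NormedAddCommGroup E] [InnerProductSpace ℝ E]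
    {u ν : E} {t : ℝ} (ht : 0 ≤ t) (hν : ‖ν‖ = 1) (h : |inner ℝ u ν| ≤ ‖u‖ / 2) :
    √(‖u‖ ^ 2 + t ^ 2) ≤ √2 * ‖u - t • ν‖ := by
  refine Real.sqrt_le_iff.2 ⟨by positivity, ?_⟩
  rw [mul_pow, Real.sq_sqrt two_pos.le]
  linarith [half_norm_sq_add_sq_le ht hν h]

/-- A lower bound for the distance to the point `t • ν` on the normal, in the form in which it
controls the kernel. -/
lemma one_div_norm_sub_pow_le {E : Type*} [NormedAddCommGroup E] [InnerProductSpace ℝ E]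
    {u ν : E} {t b : ℝ} (n : ℕ) (ht : 0 ≤ t) (hν : ‖ν‖ = 1) (h : |inner ℝ u ν| ≤ ‖u‖ / 2)
    (hb : 0 < b) (hbu : b ^ 2 ≤ ‖u‖ ^ 2 + t ^ 2) :
    1 / ‖u - t • ν‖ ^ n ≤ √2 ^ n / b ^ n := by
  have h1 : b ≤ √2 * ‖u - t • ν‖ :=
    (Real.le_sqrt_of_sq_le hbu).trans (sqrt_le_sqrt_two_mul_norm_sub ht hν h)
  have h2 : 0 < ‖u - t • ν‖ := by
    by_contra hcon
    have : ‖u - t • ν‖ = 0 := le_antisymm (not_lt.1 hcon) (norm_nonneg _)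
    rw [this, mul_zero] at h1
    linarith
  rw [div_le_div_iff₀ (pow_pos h2 n) (pow_pos hb n), one_mul, ← mul_pow]
  exact pow_le_pow_left₀ hb.le h1 n

variable {m : ℕ}

lemma norm_pair_inner_sub_unitNormal (p η : EuclideanSpace ℝ (Fin m)) :
    ‖pair η (inner ℝ p η) - unitNormal p‖ = √(1 + (‖η‖ ^ 2 + inner ℝ p η ^ 2)) := by
  have h : ‖pair η (inner ℝ p η) - unitNormal p‖ ^ 2 = 1 + (‖η‖ ^ 2 + inner ℝ p η ^ 2) := by
    rw [norm_sub_sq_real, inner_unitNormal, norm_unitNormal, norm_sq_eq_base_add_height]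
    simp; ring
  rw [← h, Real.sqrt_sq (norm_nonneg _)]

lemma areaDensity_le {ψ : EuclideanSpace ℝ (Fin m) → ℝ} {K : ℝ≥0} (hK : LipschitzWith K ψ)
    (y : EuclideanSpace ℝ (Fin m)) : areaDensity ψ y ≤ √(1 + (K : ℝ) ^ 2) := by
  have h : ‖gradient ψ y‖ ≤ K := by
    rw [gradient, LinearIsometryEquiv.norm_map]
    exact norm_fderiv_le_of_lipschitz ℝ hK
  unfold areaDensity
  gcongr

lemma continuous_graphMap {ψ : EuclideanSpace ℝ (Fin m) → ℝ} (h : Continuous ψ) :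
    Continuous (graphMap ψ) := continuous_id.pair h

lemma norm_sub_le_norm_graphMap_sub (ψ : EuclideanSpace ℝ (Fin m) → ℝ)
    (y c : EuclideanSpace ℝ (Fin m)) : ‖y - c‖ ≤ ‖graphMap ψ y - graphMap ψ c‖ := by
  simpa [graphMap] using norm_base_le (graphMap ψ y - graphMap ψ c)

/-- The blown-up graph `t⁻¹ (Φ(c + t η) - Φ(c))` tends to the tangent plane. -/
lemma tendsto_smul_graphMap_sub {ψ : EuclideanSpace ℝ (Fin m) → ℝ}
    {c : EuclideanSpace ℝ (Fin m)} (hψ : DifferentiableAt ℝ ψ c) (η : EuclideanSpace ℝ (Fin m)) :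
    Tendsto (fun t : ℝ => t⁻¹ • (graphMap ψ (c + t • η) - graphMap ψ c)) (𝓝[>] 0)
      (𝓝 (pair η (inner ℝ (gradient ψ c) η))) := by
  have hline : HasDerivAt (fun t : ℝ => c + t • η) η 0 := by
    simpa using ((hasDerivAt_id (0 : ℝ)).smul_const η).const_add c
  have hψ' : HasFDerivAt ψ (innerSL ℝ (gradient ψ c)) (c + (0 : ℝ) • η) := by
    rw [zero_smul, add_zero]
    exact hψ.hasGradientAt.hasFDerivAt
  have h1 := hasDerivAt_iff_tendsto_slope.1 (hψ'.comp_hasDerivAt 0 hline)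
  have h2 := h1.mono_left (nhdsWithin_mono (0 : ℝ) (fun t (ht : 0 < t) => ht.ne'))
  have h3 : Continuous fun τ : ℝ => pair η τ := continuous_const.pair continuous_id
  have h4 := (h3.tendsto (innerSL ℝ (gradient ψ c) η)).comp h2
  refine h4.congr' ?_
  filter_upwards [self_mem_nhdsWithin] with t ht
  have ht : t ≠ 0 := (show 0 < t from ht).ne'
  refine ext_base_height ?_ ?_
  · simp [graphMap, smul_smul, ht]
  · simp [graphMap, slope_def_field, div_eq_inv_mul]

/-- The function `(r + t) t / |x - α|ᵐ⁺¹` of `x` is, up to constants, the Poisson kernel of a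
half space with pole at distance `t`. Rescaling `y = c + t η` turns its integral over the graph into
one whose limit is the integral over the tangent plane, half of the total solid angle. -/
lemma tendsto_integral_kernel {ψ : EuclideanSpace ℝ (Fin m) → ℝ} {K : ℝ≥0}
    (hK : LipschitzWith K ψ) {c : EuclideanSpace ℝ (Fin m)} {R r : ℝ} (hR : 0 < R) (hr : 0 < r)
    (hψ : DifferentiableAt ℝ ψ c)
    (hgrad : ∀ᵐ η : EuclideanSpace ℝ (Fin m),
      Tendsto (fun t : ℝ => gradient ψ (c + t • η)) (𝓝[≠] 0) (𝓝 (gradient ψ c)))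
    (hhalf : ∀ y ∈ Metric.ball c R, |inner ℝ (graphMap ψ y - graphMap ψ c)
      (unitNormal (gradient ψ c))| ≤ ‖graphMap ψ y - graphMap ψ c‖ / 2) :
    Tendsto (fun t : ℝ => ∫ y in Metric.ball c R, areaDensity ψ y * ((r + t) * t /
        ‖graphMap ψ y - (graphMap ψ c + t • unitNormal (gradient ψ c))‖ ^ (m + 1)))
      (𝓝[>] 0) (𝓝 (r * (((m + 1 : ℕ) : ℝ) * unitBallVolume (m + 1) / 2))) := by
  set p := gradient ψ c with hp
  set ν := unitNormal p with hν
  have hν1 : ‖ν‖ = 1 := norm_unitNormal p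
  -- The integrand after rescaling: `tᵐ` from the volume and `t` from the numerator cancel `tᵐ⁺¹`.
  let H : ℝ → EuclideanSpace ℝ (Fin m) → ℝ := fun t η => (Metric.ball c R).indicator
    (fun y => areaDensity ψ y *
      ((r + t) / ‖t⁻¹ • (graphMap ψ y - graphMap ψ c) - ν‖ ^ (m + 1))) (c + t • η)
  have hscale : ∀ t : ℝ, 0 < t → ∫ y in Metric.ball c R, areaDensity ψ y * ((r + t) * t /
      ‖graphMap ψ y - (graphMap ψ c + t • ν)‖ ^ (m + 1)) = ∫ η, H t η := by
    intro t ht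
    rw [← integral_indicator measurableSet_ball, ← integral_add_left_eq_self _ c]
    have h1 := Measure.integral_comp_smul (volume : Measure (EuclideanSpace ℝ (Fin m)))
      (fun y => (Metric.ball c R).indicator (fun y => areaDensity ψ y * ((r + t) * t /
        ‖graphMap ψ y - (graphMap ψ c + t • ν)‖ ^ (m + 1))) (c + y)) t
    rw [finrank_euclideanSpace_fin, abs_of_pos (by positivity), smul_eq_mul] at h1
    have h2 : ∀ I : ℝ, I = t ^ m * ((t ^ m)⁻¹ * I) := fun I => by field_simp
    rw [h2 (∫ _, _), ← h1, ← integral_const_mul]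
    refine integral_congr_ae (Eventually.of_forall fun η => ?_)
    simp only [H, indicator]
    split_ifs with hmem
    · have h3 : graphMap ψ (c + t • η) - (graphMap ψ c + t • ν) =
          t • (t⁻¹ • (graphMap ψ (c + t • η) - graphMap ψ c) - ν) := by
        rw [smul_sub, smul_smul, mul_inv_cancel₀ ht.ne', one_smul, sub_sub]
      rw [h3, norm_smul, Real.norm_eq_abs, abs_of_pos ht, mul_pow]
      field_simp
      ring
    · simp
  have hlim : Tendsto (fun t => ∫ η, H t η) (𝓝[>] 0) (𝓝 (∫ η, r * (√(1 + ‖p‖ ^ 2) /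
      √(1 + (‖η‖ ^ 2 + inner ℝ p η ^ 2)) ^ (m + 1)))) := by
    refine tendsto_integral_filter_of_dominated_convergence
      (fun η => √(1 + (K : ℝ) ^ 2) * ((r + 1) * √2 ^ (m + 1)) * (1 / √(1 + ‖η‖ ^ 2) ^ (m + 1)))
      ?_ ?_ (integrable_one_div_sqrt_pow.const_mul _) ?_
    · refine Eventually.of_forall fun t => Measurable.aestronglyMeasurable ?_
      have h1 : Measurable fun y => areaDensity ψ y *
          ((r + t) / ‖t⁻¹ • (graphMap ψ y - graphMap ψ c) - ν‖ ^ (m + 1)) := by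
        have := (continuous_graphMap hK.continuous).measurable
        have := measurable_areaDensity ψ
        fun_prop
      exact (h1.indicator measurableSet_ball).comp (by fun_prop : Measurable fun η => c + t • η)
    · filter_upwards [Ioo_mem_nhdsGT (zero_lt_one' ℝ)] with t ht
      refine Eventually.of_forall fun η => ?_
      have hb : 0 < √(1 + ‖η‖ ^ 2) := by positivity
      simp only [H, indicator]
      split_ifs with hmem
      · set u := t⁻¹ • (graphMap ψ (c + t • η) - graphMap ψ c) with hu
        have hu1 : ‖η‖ ≤ ‖u‖ := by
          have h1 := norm_sub_le_norm_graphMap_sub ψ (c + t • η) c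
          rw [add_sub_cancel_left, norm_smul, Real.norm_eq_abs, abs_of_pos ht.1] at h1
          rw [hu, norm_smul, Real.norm_eq_abs, abs_of_pos (inv_pos.2 ht.1)]
          rw [inv_mul_eq_div, le_div_iff₀ ht.1]
          linarith
        have hu2 : |inner ℝ u ν| ≤ ‖u‖ / 2 := by
          have h1 := hhalf _ hmem
          rw [hu, inner_smul_left, norm_smul, Real.norm_eq_abs, abs_mul, mul_div_assoc]
          exact mul_le_mul_of_nonneg_left h1 (abs_nonneg _)
        have h1 := one_div_norm_sub_pow_le (m + 1) zero_le_one hν1 hu2 hb (by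
          rw [Real.sq_sqrt (by positivity)]
          nlinarith [norm_nonneg η, norm_nonneg u])
        rw [one_smul] at h1
        have hrt : 0 < r + t := by linarith [ht.1]
        rw [Real.norm_of_nonneg (mul_nonneg (areaDensity_nonneg _ _) (by positivity)),
          mul_assoc]
        refine mul_le_mul (areaDensity_le hK _) ?_ (by positivity) (Real.sqrt_nonneg _)
        calc (r + t) / ‖u - ν‖ ^ (m + 1) = (r + t) * (1 / ‖u - ν‖ ^ (m + 1)) := by ring
          _ ≤ (r + 1) * (√2 ^ (m + 1) / √(1 + ‖η‖ ^ 2) ^ (m + 1)) :=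
            mul_le_mul (by linarith [ht.2]) h1 (by positivity) (by positivity)
          _ = _ := by ring
      · rw [norm_zero]; positivity
    · filter_upwards [hgrad] with η hη
      have hη' := hη.mono_left (nhdsWithin_mono (0 : ℝ) (fun t (ht : 0 < t) => ht.ne'))
      have hJ : Tendsto (fun t : ℝ => areaDensity ψ (c + t • η)) (𝓝[>] 0)
          (𝓝 √(1 + ‖p‖ ^ 2)) := by
        unfold areaDensity
        exact (Real.continuous_sqrt.tendsto _).comp ((hη'.norm.pow 2).const_add 1)
      have hden := ((tendsto_smul_graphMap_sub hψ η).sub_const ν).norm.pow (m + 1)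
      rw [hν, norm_pair_inner_sub_unitNormal] at hden
      have hnum : Tendsto (fun t : ℝ => r + t) (𝓝[>] 0) (𝓝 (r + 0)) :=
        ((continuous_const.add continuous_id).tendsto 0).mono_left nhdsWithin_le_nhds
      rw [add_zero] at hnum
      have hquot := hJ.mul (hnum.div hden (by positivity))
      have hball : ∀ᶠ t : ℝ in 𝓝[>] 0, c + t • η ∈ Metric.ball c R := by
        have hcont : Continuous fun t : ℝ => c + t • η := by fun_prop
        refine (hcont.tendsto 0).mono_left nhdsWithin_le_nhds (Metric.isOpen_ball.mem_nhds ?_)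
        simpa using hR
      have heq : √(1 + ‖p‖ ^ 2) * (r / √(1 + (‖η‖ ^ 2 + inner ℝ p η ^ 2)) ^ (m + 1)) =
          r * (√(1 + ‖p‖ ^ 2) / √(1 + (‖η‖ ^ 2 + inner ℝ p η ^ 2)) ^ (m + 1)) := by ring
      rw [← heq]
      refine hquot.congr' ?_
      filter_upwards [hball] with t ht
      simp only [H, indicator_of_mem ht]
      rfl
  rw [integral_const_mul, integral_sqrt_div_sqrt_pow] at hlim
  refine hlim.congr' ?_
  filter_upwards [self_mem_nhdsWithin] with t ht
  exact (hscale t ht).symm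

end Blowup

/-! ### Upper bound for the surface integral -/

section UpperBound
variable {m : ℕ}

/-- No integrability of `f` on `S` is needed: without it the left side is `0`. -/
lemma setIntegral_le_toReal_setLIntegral {X : Type*} [MeasurableSpace X] {μ : Measure X}
    {S T : Set X} (hST : S ⊆ T) {f : X → ℝ}
    (hfin : ∫⁻ x in T, ENNReal.ofReal (f x) ∂μ ≠ ∞) :
    ∫ x in S, f x ∂μ ≤ (∫⁻ x in T, ENNReal.ofReal (f x) ∂μ).toReal := by
  by_cases hf : IntegrableOn f S μ
  · rw [integral_eq_lintegral_pos_part_sub_lintegral_neg_part hf]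
    have h1 := ENNReal.toReal_mono hfin
      (lintegral_mono_set (f := fun x => ENNReal.ofReal (f x)) (μ := μ) hST)
    have h2 : 0 ≤ (∫⁻ x in S, ENNReal.ofReal (-f x) ∂μ).toReal := ENNReal.toReal_nonneg
    linarith
  · rw [integral_undef hf]
    exact ENNReal.toReal_nonneg

lemma integrableOn_inv_norm_sub_pow_ball (hm : 1 ≤ m) (c : EuclideanSpace ℝ (Fin m)) (R : ℝ) :
    IntegrableOn (fun y => (‖y - c‖ ^ (m - 1))⁻¹) (Metric.ball c R) := by
  have : Nonempty (Fin m) := ⟨⟨0, hm⟩⟩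
  have h1 : Integrable (fun y : EuclideanSpace ℝ (Fin m) =>
      (Iio R).indicator (fun ρ : ℝ => (ρ ^ (m - 1))⁻¹) ‖y‖) := by
    rw [integrable_fun_norm_addHaar volume (f := (Iio R).indicator fun ρ : ℝ => (ρ ^ (m - 1))⁻¹),
      finrank_euclideanSpace_fin]
    have h2 : IntegrableOn ((Iio R).indicator fun _ : ℝ => (1 : ℝ)) (Ioi 0) := by
      rw [IntegrableOn, integrable_indicator_iff measurableSet_Iio, IntegrableOn,
        Measure.restrict_restrict measurableSet_Iio, Iio_inter_Ioi]
      exact integrableOn_const (by simp)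
    refine h2.congr_fun (fun ρ hρ => ?_) measurableSet_Ioi
    have hρ : 0 < ρ := hρ
    simp only [indicator]
    split_ifs
    · rw [smul_eq_mul, mul_inv_cancel₀ (by positivity)]
    · simp
  have h3 := h1.comp_sub_right c
  rw [← integrable_indicator_iff measurableSet_ball]
  refine h3.congr (Eventually.of_forall fun y => ?_)
  simp [indicator, dist_eq_norm]

/-- The kernel at a boundary point `x`, seen from `z + t ν`. Only the positive part of
`-⟨x - z, ν⟩` matters, and the touching ball makes it at most quadratic. In the application `d` is
the distance of the base points of `x` and `z`. -/
lemma kernel_le {E : Type*} [NormedAddCommGroup E] [InnerProductSpace ℝ E] {x z ν x₀ : E}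
    {r t d : ℝ} (hm : 1 ≤ m) (hr : 0 < r) (ht : 0 < t) (hν : ‖ν‖ = 1) (hz : z - x₀ = r • ν)
    (hx : r ≤ ‖x - x₀‖) (hhalf : |inner ℝ (x - z) ν| ≤ ‖x - z‖ / 2)
    (hd : 0 ≤ d) (hdx : d ≤ ‖x - z‖) (hd0 : d = 0 → x = z) :
    inner ℝ (z + t • ν - x) (z + t • ν - x₀) / ‖x - (z + t • ν)‖ ^ (m + 1) ≤
      (r + t) * t / ‖x - (z + t • ν)‖ ^ (m + 1) +
        (r + t) * (√2 ^ (m + 1) / (2 * r)) * (d ^ (m - 1))⁻¹ := by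
  set u := x - z with hu
  have hq : -(‖u‖ ^ 2) ≤ 2 * r * inner ℝ u ν := by
    have h1 : x - x₀ = u + r • ν := by rw [← hz, hu]; abel
    have h2 : r ^ 2 ≤ ‖x - x₀‖ ^ 2 := by gcongr
    rw [h1, norm_add_sq_real, inner_smul_right, norm_smul, hν, Real.norm_eq_abs, mul_one,
      sq_abs] at h2
    linarith
  have h3 : z + t • ν - x = t • ν - u := by rw [hu]; abel
  have h4 : z + t • ν - x₀ = (r + t) • ν := by rw [add_smul, ← hz]; abel
  have h5 : x - (z + t • ν) = u - t • ν := by rw [hu]; abel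
  have hνν : inner ℝ ν ν = 1 := by rw [real_inner_self_eq_norm_sq, hν]; norm_num
  have h6 : inner ℝ (z + t • ν - x) (z + t • ν - x₀) = (r + t) * (t - inner ℝ u ν) := by
    rw [h3, h4, inner_smul_right, inner_sub_left, inner_smul_left, hνν]
    simp
  rw [h6, h5]
  have hsplit : (r + t) * (t - inner ℝ u ν) / ‖u - t • ν‖ ^ (m + 1) =
      (r + t) * t / ‖u - t • ν‖ ^ (m + 1) +
        (r + t) * (-inner ℝ u ν * (1 / ‖u - t • ν‖ ^ (m + 1))) := by ring
  rw [hsplit, mul_assoc (r + t)]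
  refine add_le_add le_rfl (mul_le_mul_of_nonneg_left ?_ (by positivity))
  rcases (norm_nonneg u).eq_or_lt with h0 | hpos
  · have hu0 : u = 0 := norm_eq_zero.1 h0.symm
    rw [hu0]
    simp only [inner_zero_left, neg_zero, zero_mul]
    positivity
  have hdpos : 0 < d := by
    rcases hd.eq_or_lt with h | h
    · rw [hu, hd0 h.symm, sub_self, norm_zero] at hpos
      exact absurd hpos (lt_irrefl 0)
    · exact h
  have h7 := one_div_norm_sub_pow_le (m + 1) ht.le hν hhalf hpos (by nlinarith [sq_nonneg t])
  have h8 : -inner ℝ u ν ≤ ‖u‖ ^ 2 / (2 * r) := by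
    rw [le_div_iff₀ (by positivity)]; linarith
  obtain ⟨k, rfl⟩ : ∃ k, m = k + 1 := ⟨m - 1, by omega⟩
  calc -inner ℝ u ν * (1 / ‖u - t • ν‖ ^ (k + 1 + 1))
      ≤ ‖u‖ ^ 2 / (2 * r) * (1 / ‖u - t • ν‖ ^ (k + 1 + 1)) := by gcongr
    _ ≤ ‖u‖ ^ 2 / (2 * r) * (√2 ^ (k + 1 + 1) / ‖u‖ ^ (k + 1 + 1)) := by gcongr
    _ = √2 ^ (k + 1 + 1) / (2 * r) * (‖u‖ ^ k)⁻¹ := by field_simp; ring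
    _ ≤ √2 ^ (k + 1 + 1) / (2 * r) * (d ^ (k + 1 - 1))⁻¹ := by
      rw [Nat.add_sub_cancel]; gcongr

lemma integrableOn_areaDensity_mul {ψ : EuclideanSpace ℝ (Fin m) → ℝ} {K : ℝ≥0}
    (hK : LipschitzWith K ψ) {S : Set (EuclideanSpace ℝ (Fin m))}
    {g : EuclideanSpace ℝ (Fin m) → ℝ} (hg : IntegrableOn g S) :
    IntegrableOn (fun y => areaDensity ψ y * g y) S := by
  refine hg.bdd_mul (c := √(1 + (K : ℝ) ^ 2)) (measurable_areaDensity ψ).aestronglyMeasurable ?_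
  refine Eventually.of_forall fun y => ?_
  rw [Real.norm_of_nonneg (areaDensity_nonneg _ _)]
  exact areaDensity_le hK y

/-- The surface integral over a piece of the graph, seen from `z + t ν`. -/
lemma setIntegral_kernel_le (hm : 1 ≤ m) {ψ : EuclideanSpace ℝ (Fin m) → ℝ} {K : ℝ≥0}
    (hK : LipschitzWith K ψ) {c : EuclideanSpace ℝ (Fin m)} {R r t : ℝ} (hr : 0 < r) (ht : 0 < t)
    (hdiff : ∀ y ∈ Metric.ball c R, DifferentiableAt ℝ ψ y)
    {ν x₀ : EuclideanSpace ℝ (Fin (m + 1))} (hν : ‖ν‖ = 1) (hz : graphMap ψ c - x₀ = r • ν)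
    (hx : ∀ y ∈ Metric.ball c R, r ≤ ‖graphMap ψ y - x₀‖)
    (hhalf : ∀ y ∈ Metric.ball c R,
      |inner ℝ (graphMap ψ y - graphMap ψ c) ν| ≤ ‖graphMap ψ y - graphMap ψ c‖ / 2)
    {S : Set (EuclideanSpace ℝ (Fin (m + 1)))} (hS : S ⊆ graphMap ψ '' Metric.ball c R) :
    ∫ x in S, inner ℝ (graphMap ψ c + t • ν - x) (graphMap ψ c + t • ν - x₀) /
        ‖x - (graphMap ψ c + t • ν)‖ ^ (m + 1) ∂μHE[m] ≤
      (∫ y in Metric.ball c R, areaDensity ψ y * ((r + t) * t /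
        ‖graphMap ψ y - (graphMap ψ c + t • ν)‖ ^ (m + 1))) +
      (r + t) * (√2 ^ (m + 1) / (2 * r)) *
        ∫ y in Metric.ball c R, areaDensity ψ y * (‖y - c‖ ^ (m - 1))⁻¹ := by
  set z := graphMap ψ c
  set f : EuclideanSpace ℝ (Fin (m + 1)) → ℝ := fun x =>
    inner ℝ (z + t • ν - x) (z + t • ν - x₀) / ‖x - (z + t • ν)‖ ^ (m + 1) with hf
  set g₁ : EuclideanSpace ℝ (Fin m) → ℝ := fun y =>
    (r + t) * t / ‖graphMap ψ y - (z + t • ν)‖ ^ (m + 1) with hg₁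
  set C := (r + t) * (√2 ^ (m + 1) / (2 * r)) with hC
  have hC0 : 0 ≤ C := by positivity
  set g₂ : EuclideanSpace ℝ (Fin m) → ℝ := fun y => (‖y - c‖ ^ (m - 1))⁻¹ with hg₂
  have hcont := continuous_graphMap hK.continuous
  have hg₁int : IntegrableOn g₁ (Metric.ball c R) := by
    refine Measure.integrableOn_of_bounded (M := (r + t) * t * (√2 ^ (m + 1) / t ^ (m + 1)))
      measure_ball_lt_top.ne ?_ ?_
    · have := hcont.measurable
      exact (by fun_prop : Measurable g₁).aestronglyMeasurable
    · filter_upwards [ae_restrict_mem measurableSet_ball] with y hy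
      have h1 := one_div_norm_sub_pow_le (m + 1) ht.le hν (hhalf y hy) ht
        (by nlinarith [sq_nonneg ‖graphMap ψ y - z‖])
      rw [sub_sub] at h1
      rw [Real.norm_of_nonneg (by positivity)]
      calc g₁ y = (r + t) * t * (1 / ‖graphMap ψ y - (z + t • ν)‖ ^ (m + 1)) := by
            rw [hg₁]; ring
        _ ≤ _ := by gcongr
  have hg₂int : IntegrableOn g₂ (Metric.ball c R) := integrableOn_inv_norm_sub_pow_ball hm c R
  have hJ₁ := integrableOn_areaDensity_mul hK hg₁int
  have hJ₂ := integrableOn_areaDensity_mul hK hg₂int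
  have hpt : ∀ y ∈ Metric.ball c R, f (graphMap ψ y) ≤ g₁ y + C * g₂ y := by
    intro y hy
    refine kernel_le hm hr ht hν hz (hx y hy) (hhalf y hy) (norm_nonneg _)
      (norm_sub_le_norm_graphMap_sub ψ y c) fun h => ?_
    rw [sub_eq_zero.1 (norm_eq_zero.1 h)]
  have hle : ∫⁻ x in graphMap ψ '' Metric.ball c R, ENNReal.ofReal (f x) ∂μHE[m] ≤
      ENNReal.ofReal (∫ y in Metric.ball c R,
        (areaDensity ψ y * g₁ y + C * (areaDensity ψ y * g₂ y))) := by
    refine (lintegral_graphMap_image_le hm hK.continuous measurableSet_ball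
      measure_ball_lt_top.ne hdiff (Measurable.ennreal_ofReal (by fun_prop))).trans ?_
    have hsum : IntegrableOn (fun y => areaDensity ψ y * g₁ y + C * (areaDensity ψ y * g₂ y))
        (Metric.ball c R) := hJ₁.add (hJ₂.const_mul C)
    rw [ofReal_integral_eq_lintegral_ofReal hsum]
    · refine setLIntegral_mono_ae' measurableSet_ball (Eventually.of_forall fun y hy => ?_)
      rw [← ENNReal.ofReal_mul (areaDensity_nonneg _ _)]
      refine ENNReal.ofReal_le_ofReal ?_
      calc areaDensity ψ y * f (graphMap ψ y) ≤ areaDensity ψ y * (g₁ y + C * g₂ y) :=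
            mul_le_mul_of_nonneg_left (hpt y hy) (areaDensity_nonneg _ _)
        _ = _ := by ring
    · refine Eventually.of_forall fun y => ?_
      have := areaDensity_nonneg ψ y
      change 0 ≤ areaDensity ψ y * g₁ y + C * (areaDensity ψ y * g₂ y)
      positivity
  refine (setIntegral_le_toReal_setLIntegral hS
    (ne_top_of_le_ne_top ENNReal.ofReal_ne_top hle)).trans ?_
  have h1 := ENNReal.toReal_mono ENNReal.ofReal_ne_top hle
  refine h1.trans_eq ?_
  rw [integral_add hJ₁ (hJ₂.const_mul C), integral_const_mul, ENNReal.toReal_ofReal]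
  have h3 : 0 ≤ ∫ y in Metric.ball c R, areaDensity ψ y * g₁ y :=
    integral_nonneg fun y => mul_nonneg (areaDensity_nonneg _ _) (by positivity)
  have h4 : 0 ≤ ∫ y in Metric.ball c R, areaDensity ψ y * g₂ y :=
    integral_nonneg fun y => mul_nonneg (areaDensity_nonneg _ _) (by positivity)
  positivity

lemma tendsto_setIntegral_ball_zero (hm : 1 ≤ m) {c : EuclideanSpace ℝ (Fin m)} {R₀ : ℝ}
    (hR₀ : 0 < R₀) {g : EuclideanSpace ℝ (Fin m) → ℝ} (hg : IntegrableOn g (Metric.ball c R₀)) :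
    Tendsto (fun R => ∫ y in Metric.ball c R, g y) (𝓝[>] 0) (𝓝 0) := by
  have : Nonempty (Fin m) := ⟨⟨0, hm⟩⟩
  have hvol : Tendsto (fun R : ℝ => volume (Metric.ball c R)) (𝓝[>] 0) (𝓝 0) := by
    have h1 : Tendsto (fun R : ℝ => ENNReal.ofReal R ^ m *
        volume (Metric.ball (0 : EuclideanSpace ℝ (Fin m)) 1)) (𝓝[>] 0) (𝓝 (0 *
          volume (Metric.ball (0 : EuclideanSpace ℝ (Fin m)) 1))) := by
      refine ENNReal.Tendsto.mul_const ?_ (Or.inr measure_ball_lt_top.ne)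
      have h2 : Continuous fun R : ℝ => ENNReal.ofReal R ^ m :=
        (ENNReal.continuous_pow m).comp ENNReal.continuous_ofReal
      have h3 := (h2.tendsto 0).mono_left (nhdsWithin_le_nhds (s := Ioi 0))
      simpa [show m ≠ 0 by omega] using h3
    rw [zero_mul] at h1
    refine h1.congr' ?_
    filter_upwards [self_mem_nhdsWithin] with R hR
    rw [Measure.addHaar_ball _ _ (le_of_lt hR), finrank_euclideanSpace_fin,
      ENNReal.ofReal_pow (le_of_lt hR)]
  have h2 : Tendsto ((volume.restrict (Metric.ball c R₀)) ∘ fun R : ℝ => Metric.ball c R)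
      (𝓝[>] 0) (𝓝 0) :=
    tendsto_of_tendsto_of_tendsto_of_le_of_le tendsto_const_nhds hvol (fun _ => zero_le)
      (fun R => Measure.restrict_apply_le _ _)
  refine (Integrable.tendsto_setIntegral_nhds_zero hg h2).congr' ?_
  filter_upwards [Ioo_mem_nhdsGT hR₀] with R hR
  rw [Measure.restrict_restrict measurableSet_ball,
    inter_eq_left.2 (Metric.ball_subset_ball hR.2.le)]

end UpperBound

/-! ### The bound in graph coordinates -/

section Chart
variable {m : ℕ}

lemma isOpen_boxNhd (z : EuclideanSpace ℝ (Fin (m + 1))) (R a b : ℝ) : IsOpen (boxNhd z R a b) :=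
  (Metric.isOpen_ball.preimage continuous_base).inter (isOpen_Ioo.preimage continuous_height)

lemma gradient_congr_on_ball {ψ φ : EuclideanSpace ℝ (Fin m) → ℝ} {c : EuclideanSpace ℝ (Fin m)}
    {R : ℝ} (h : EqOn ψ φ (Metric.ball c R)) :
    EqOn (gradient ψ) (gradient φ) (Metric.ball c R) := by
  intro y hy
  have h1 : ψ =ᶠ[𝓝 y] φ := h.eventuallyEq_of_mem (Metric.isOpen_ball.mem_nhds hy)
  simp only [gradient, h1.fderiv_eq]

/-- The function in a Lipschitz flat chart may be taken globally Lipschitz, with the description of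
`∂Ω` and `Ω` in the chart stated pointwise. -/
lemma LipschitzFlatInCoordinates.exists_lipschitzWith {Ω : Set (EuclideanSpace ℝ (Fin (m + 1)))}
    {z : EuclideanSpace ℝ (Fin (m + 1))} (h : LipschitzFlatInCoordinates Ω z) :
    ∃ (ψ : EuclideanSpace ℝ (Fin m) → ℝ) (K : ℝ≥0) (R a b : ℝ),
      0 < R ∧ z ∈ boxNhd z R a b ∧ LipschitzWith K ψ ∧
      (∀ y ∈ Metric.ball (base z) R, graphMap ψ y ∈ boxNhd z R a b) ∧
      (∀ y ∈ Metric.ball (base z) R, DifferentiableAt ℝ ψ y) ∧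
      (∀ᵐ ξ : EuclideanSpace ℝ (Fin m), Tendsto (fun t : ℝ => gradient ψ (base z + t • ξ))
        (𝓝[≠] 0) (𝓝 (gradient ψ (base z)))) ∧
      (∀ x ∈ boxNhd z R a b, x ∈ frontier Ω ↔ height x = ψ (base x)) ∧
      (∀ x ∈ boxNhd z R a b, x ∈ Ω ↔ height x < ψ (base x)) := by
  obtain ⟨ψ₀, R, a, b, hR, ha, hb, hmaps, ⟨K, hK⟩, hdiff, hgrad, hfr, hΩ⟩ := h
  obtain ⟨ψ, hψ, heq⟩ := hK.extend_real
  have hgeq := gradient_congr_on_ball heq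
  have hc : base z ∈ Metric.ball (base z) R := Metric.mem_ball_self hR
  refine ⟨ψ, K, R, a, b, hR, ⟨hc, ha, hb⟩, hψ, fun y hy => ?_, fun y hy => ?_, ?_, fun x hx => ?_,
    fun x hx => ?_⟩
  · have := hmaps hy
    rw [heq hy] at this
    exact ⟨by simpa [graphMap] using hy, by simpa [graphMap] using this⟩
  · have hn := Metric.isOpen_ball.mem_nhds hy
    exact ((hdiff y hy).differentiableAt hn).congr_of_eventuallyEq
      (heq.symm.eventuallyEq_of_mem hn)
  · filter_upwards [hgrad] with ξ hξ
    rw [← hgeq hc]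
    refine hξ.congr' ?_
    have hcont : Continuous fun t : ℝ => base z + t • ξ := by fun_prop
    have hev : ∀ᶠ t : ℝ in 𝓝 0, base z + t • ξ ∈ Metric.ball (base z) R :=
      (hcont.tendsto 0) (Metric.isOpen_ball.mem_nhds (by simpa using hR))
    filter_upwards [hev.filter_mono nhdsWithin_le_nhds] with t ht
    exact hgeq ht
  · have h1 := Set.ext_iff.1 hfr x
    simp only [mem_inter_iff, hx, and_true, mem_ofPred_eq, hx.1, true_and] at h1
    rw [h1, heq hx.1]
  · have h1 := Set.ext_iff.1 hΩ x
    simp only [mem_inter_iff, hx, and_true, mem_ofPred_eq, hx.1, true_and, hx.2.1] at h1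
    rw [h1, heq hx.1]

/-- The bound for a domain that is the subgraph of `ψ` near `z` in the given coordinates. -/
theorem sphericalFlatnessIndex_le_one_of_coordinates (hm : 1 ≤ m)
    {Ω : Set (EuclideanSpace ℝ (Fin (m + 1)))} (hΩ : IsOpen Ω)
    {x₀ z : EuclideanSpace ℝ (Fin (m + 1))} (hx₀ : x₀ ∈ Ω) (hz : z ∈ touchingSet Ω x₀)
    (hflat : LipschitzFlatInCoordinates Ω z) : sphericalFlatnessIndex Ω x₀ z ≤ 1 := by
  obtain ⟨hzf, hzd⟩ := hz
  obtain ⟨ψ, K, R₀, a, b, hR₀, hzbox, hK, hgraph, hdiff, hgrad, hfr, hbelow⟩ :=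
    hflat.exists_lipschitzWith
  set c := base z with hc
  set p := gradient ψ c with hp
  set ν := unitNormal p with hνdef
  set r := dist x₀ z with hr_def
  have hcR : c ∈ Metric.ball c R₀ := Metric.mem_ball_self hR₀
  have hψc := hdiff c hcR
  have hν : ‖ν‖ = 1 := norm_unitNormal p
  have hzgraph : z = graphMap ψ c :=
    ext_base_height (by simp [graphMap, hc]) (by simpa [graphMap, hc] using (hfr z hzbox).1 hzf)
  have hr : 0 < r := by
    refine dist_pos.2 fun h => ?_
    have : z ∈ Ω ∩ frontier Ω := ⟨h ▸ hx₀, hzf⟩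
    rw [hΩ.inter_frontier_eq] at this
    exact this
  have hfar : ∀ y ∈ Metric.ball c R₀, r ≤ ‖graphMap ψ y - x₀‖ := by
    intro y hy
    have h1 : graphMap ψ y ∈ frontier Ω := (hfr _ (hgraph y hy)).2 (by simp [graphMap])
    rw [← dist_eq_norm, dist_comm, hzd]
    exact Metric.infDist_le_dist_of_mem h1
  -- Points slightly above the graph lie outside the closure of `Ω`.
  have hout : ∀ᶠ t : ℝ in 𝓝[>] 0, z + t • ν ∈ (closure Ω)ᶜ := by
    have hcont : Continuous fun t : ℝ => z + t • ν := by fun_prop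
    have hbox : ∀ᶠ t : ℝ in 𝓝 0, z + t • ν ∈ boxNhd z R₀ a b :=
      (hcont.tendsto 0) ((isOpen_boxNhd z R₀ a b).mem_nhds (by simpa using hzbox))
    filter_upwards [hbox.filter_mono nhdsWithin_le_nhds,
      eventually_lt_height_add_smul_unitNormal hψc] with t ht1 ht2
    rw [← hzgraph] at ht2
    rw [closure_eq_self_union_frontier, mem_compl_iff, mem_union, hfr _ ht1, hbelow _ ht1]
    rintro (h | h)
    · exact lt_asymm h ht2
    · exact ht2.ne' h
  have hnormal : z - x₀ = r • ν := by
    have hmin : IsLocalMin (fun y => ‖graphMap ψ y - x₀‖ ^ 2) c := by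
      filter_upwards [Metric.isOpen_ball.mem_nhds hcR] with y hy
      rw [← hzgraph, ← dist_eq_norm z, dist_comm]
      have := hfar y hy
      gcongr
    have h1 := sub_eq_smul_of_isLocalMin hψc hmin
    rw [← hzgraph] at h1
    set l := height (z - x₀)
    set s := √(1 + ‖p‖ ^ 2) with hs
    have hs0 : 0 < s := by positivity
    have h2 : z - x₀ = (l * s) • ν := by
      rw [hνdef, unitNormal, smul_smul, mul_assoc, mul_inv_cancel₀ hs0.ne', mul_one]
      exact h1
    have h3 : |l * s| = r := by
      rw [hr_def, dist_comm, dist_eq_norm, h2, norm_smul, hν, mul_one, Real.norm_eq_abs]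
    rcases abs_choice (l * s) with h | h
    · rw [h2, ← h3, h]
    -- If `ν` pointed towards `x₀`, points `z + t ν` would lie in the ball about `x₀`, hence in `Ω`.
    · exfalso
      have h4 : z - x₀ = -(r • ν) := by
        rw [h2, ← h3, h, neg_smul, neg_neg]
      obtain ⟨t, ht1, ht2⟩ := (hout.and (Ioo_mem_nhdsGT hr)).exists
      refine ht1 (subset_closure (ball_infDist_frontier_subset hΩ hx₀ ?_))
      have h5 : z + t • ν - x₀ = (t - r) • ν := by
        rw [add_sub_right_comm, h4, sub_smul]; abel
      rw [← hzd, Metric.mem_ball, dist_eq_norm, h5, norm_smul, hν, mul_one, Real.norm_eq_abs,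
        abs_lt]
      exact ⟨by linarith [ht2.1], by linarith [ht2.2]⟩
  obtain ⟨R₁, hR₁, hhalf⟩ : ∃ R₁ > 0, ∀ y ∈ Metric.ball c R₁,
      |inner ℝ (graphMap ψ y - graphMap ψ c) ν| ≤ ‖graphMap ψ y - graphMap ψ c‖ / 2 := by
    have h1 := (inner_graphMap_sub_isLittleO hψc).def (show (0 : ℝ) < 1 / 2 by norm_num)
    obtain ⟨R₁, hR₁, h2⟩ := Metric.eventually_nhds_iff_ball.1 h1
    refine ⟨R₁, hR₁, fun y hy => (h2 y hy).trans ?_⟩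
    linarith [norm_sub_le_norm_graphMap_sub ψ y c]
  obtain ⟨R₂, hR₂, hsub⟩ := Metric.isOpen_iff.1 (isOpen_boxNhd z R₀ a b) z hzbox
  have htend : Tendsto (fun t : ℝ => z + t • ν) (𝓝[>] 0) (𝓝[(closure Ω)ᶜ] z) := by
    refine tendsto_nhdsWithin_iff.2 ⟨?_, hout⟩
    have hcont : Continuous fun t : ℝ => z + t • ν := by fun_prop
    simpa using (hcont.tendsto 0).mono_left (nhdsWithin_le_nhds (s := Ioi 0))
  -- `L` is half of the total solid angle and `M * D R` accounts for the quadratic error term.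
  set L := ((m + 1 : ℕ) : ℝ) * unitBallVolume (m + 1) / 2 with hL
  have hL0 : 0 < L := by have := unitBallVolume_pos (m + 1); positivity
  set D : ℝ → ℝ := fun R =>
    ∫ y in Metric.ball c R, areaDensity ψ y * (‖y - c‖ ^ (m - 1))⁻¹ with hD
  set M := √2 ^ (m + 1) / (2 * r) with hM
  have hinner : ∀ R ∈ Ioo 0 (min R₀ (min R₁ R₂)),
      liminf (fun α : EuclideanSpace ℝ (Fin (m + 1)) =>
        ((∫ x in frontier Ω ∩ Metric.ball z R,
            inner ℝ (α - x) (α - x₀) / ‖x - α‖ ^ (m + 1) ∂μHE[m + 1 - 1] : ℝ) : EReal))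
        (𝓝[(closure Ω)ᶜ] z) ≤ ((r * L + r * M * D R : ℝ) : EReal) := by
    rintro R ⟨hRpos, hRlt⟩
    obtain ⟨hRR₀, hRR₁, hRR₂⟩ : R < R₀ ∧ R < R₁ ∧ R < R₂ := by
      simpa using hRlt
    have hsubR₀ : Metric.ball c R ⊆ Metric.ball c R₀ := Metric.ball_subset_ball hRR₀.le
    have hhalfR : ∀ y ∈ Metric.ball c R, |inner ℝ (graphMap ψ y - graphMap ψ c) ν| ≤
        ‖graphMap ψ y - graphMap ψ c‖ / 2 := fun y hy =>
      hhalf y (Metric.ball_subset_ball hRR₁.le hy)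
    have himg : frontier Ω ∩ Metric.ball z R ⊆ graphMap ψ '' Metric.ball c R := by
      rintro x ⟨hxf, hxR⟩
      have hxbox := hsub (Metric.ball_subset_ball hRR₂.le hxR)
      refine ⟨base x, ?_, ext_base_height (by simp [graphMap])
        (by simpa [graphMap] using ((hfr x hxbox).1 hxf).symm)⟩
      rw [Metric.mem_ball, dist_eq_norm] at hxR ⊢
      rw [hc, ← base_sub]
      exact (norm_base_le _).trans_lt hxR
    have hmain := tendsto_integral_kernel hK hRpos hr hψc hgrad hhalfR
    have hrt : Tendsto (fun t : ℝ => (r + t) * M * D R) (𝓝[>] 0) (𝓝 (r * M * D R)) := by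
      have hcont : Continuous fun t : ℝ => (r + t) * M * D R := by fun_prop
      simpa using (hcont.tendsto 0).mono_left (nhdsWithin_le_nhds (s := Ioi 0))
    have hlim := (continuous_coe_real_ereal.tendsto _).comp (hmain.add hrt)
    refine (liminf_le_liminf_of_le htend).trans ?_
    rw [← liminf_comp]
    refine (liminf_le_liminf ?_).trans_eq hlim.liminf_eq
    filter_upwards [self_mem_nhdsWithin] with t ht
    have h1 := setIntegral_kernel_le hm hK (x₀ := x₀) hr ht (fun y hy => hdiff y (hsubR₀ hy)) hν
      (by rw [← hzgraph]; exact hnormal) (fun y hy => hfar y (hsubR₀ hy)) hhalfR himg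
    rw [← hzgraph] at h1
    refine EReal.coe_le_coe_iff.2 ?_
    simpa [← hzgraph] using h1
  have hDlim : Tendsto D (𝓝[>] 0) (𝓝 0) :=
    tendsto_setIntegral_ball_zero hm hR₀
      (integrableOn_areaDensity_mul hK (integrableOn_inv_norm_sub_pow_ball hm c R₀))
  have houter : liminf (fun R : ℝ =>
      liminf (fun α : EuclideanSpace ℝ (Fin (m + 1)) =>
        ((∫ x in frontier Ω ∩ Metric.ball z R,
            inner ℝ (α - x) (α - x₀) / ‖x - α‖ ^ (m + 1) ∂μHE[m + 1 - 1] : ℝ) : EReal))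
        (𝓝[(closure Ω)ᶜ] z)) (𝓝[>] (0 : ℝ)) ≤ ((r * L : ℝ) : EReal) := by
    have h1 : Tendsto (fun R => r * L + r * M * D R) (𝓝[>] 0) (𝓝 (r * L)) := by
      simpa using (hDlim.const_mul (r * M)).const_add (r * L)
    have h2 := (continuous_coe_real_ereal.tendsto _).comp h1
    refine (liminf_le_liminf ?_).trans_eq h2.liminf_eq
    filter_upwards [Ioo_mem_nhdsGT (lt_min hR₀ (lt_min hR₁ hR₂))] with R hR
    exact hinner R hR
  unfold sphericalFlatnessIndex
  have hu := unitBallVolume_pos (m + 1)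
  refine (mul_le_mul_of_nonneg_left houter (EReal.coe_nonneg.2 (by positivity))).trans ?_
  rw [← EReal.coe_mul, ← EReal.coe_one, EReal.coe_le_coe_iff]
  refine le_of_eq ?_
  rw [hL, ← hr_def]
  field_simp

end Chart

/-! ### Invariance under linear isometries -/

section Isometry
variable {n : ℕ}

/-- The spherical flatness index does not depend on the choice of orthonormal coordinates. -/
lemma sphericalFlatnessIndex_image (e : EuclideanSpace ℝ (Fin n) ≃ₗᵢ[ℝ] EuclideanSpace ℝ (Fin n))
    (Ω : Set (EuclideanSpace ℝ (Fin n))) (x₀ z : EuclideanSpace ℝ (Fin n)) :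
    sphericalFlatnessIndex (e '' Ω) (e x₀) (e z) = sphericalFlatnessIndex Ω x₀ z := by
  have hfr : frontier (e '' Ω) = e '' frontier Ω :=
    (e.toHomeomorph.image_frontier Ω).symm
  have hcl : closure (e '' Ω) = e '' closure Ω :=
    (e.toHomeomorph.image_closure Ω).symm
  have hfilter : 𝓝[(closure (e '' Ω))ᶜ] (e z) = map e (𝓝[(closure Ω)ᶜ] z) := by
    rw [hcl, ← image_compl_eq e.bijective]
    have hemb : IsEmbedding e := e.toHomeomorph.isEmbedding
    exact (hemb.map_nhdsWithin_eq _ _).symm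
  have hemb : MeasurableEmbedding e := e.toHomeomorph.measurableEmbedding
  have hmp : MeasurePreserving e (μHE[n - 1]) (μHE[n - 1]) :=
    e.toIsometryEquiv.measurePreserving_euclideanHausdorffMeasure (n - 1)
  have hint : ∀ (R : ℝ) (α : EuclideanSpace ℝ (Fin n)),
      ∫ x in frontier (e '' Ω) ∩ Metric.ball (e z) R,
        inner ℝ (e α - x) (e α - e x₀) / ‖x - e α‖ ^ n ∂μHE[n - 1] =
      ∫ x in frontier Ω ∩ Metric.ball z R,
        inner ℝ (α - x) (α - x₀) / ‖x - α‖ ^ n ∂μHE[n - 1] := by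
    intro R α
    have hset : frontier (e '' Ω) ∩ Metric.ball (e z) R = e '' (frontier Ω ∩ Metric.ball z R) := by
      rw [hfr, image_inter e.injective, e.image_ball]
    rw [hset, hmp.setIntegral_image_emb hemb]
    simp only [← map_sub, e.inner_map_map, e.norm_map]
  have hlim : ∀ R : ℝ, liminf (fun α : EuclideanSpace ℝ (Fin n) =>
        ((∫ x in frontier (e '' Ω) ∩ Metric.ball (e z) R,
          inner ℝ (α - x) (α - e x₀) / ‖x - α‖ ^ n ∂μHE[n - 1] : ℝ) : EReal))
        (𝓝[(closure (e '' Ω))ᶜ] (e z)) =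
      liminf (fun α : EuclideanSpace ℝ (Fin n) =>
        ((∫ x in frontier Ω ∩ Metric.ball z R,
          inner ℝ (α - x) (α - x₀) / ‖x - α‖ ^ n ∂μHE[n - 1] : ℝ) : EReal))
        (𝓝[(closure Ω)ᶜ] z) := by
    intro R
    rw [hfilter, ← liminf_comp]
    exact congrArg (fun F => liminf F (𝓝[(closure Ω)ᶜ] z))
      (funext fun α => congrArg Real.toEReal (hint R α))
  unfold sphericalFlatnessIndex
  rw [e.dist_map]
  exact congrArg (fun F => _ * liminf F (𝓝[>] (0 : ℝ))) (funext hlim)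

lemma image_mem_touchingSet {Ω : Set (EuclideanSpace ℝ (Fin n))} {x₀ z : EuclideanSpace ℝ (Fin n)}
    (e : EuclideanSpace ℝ (Fin n) ≃ₗᵢ[ℝ] EuclideanSpace ℝ (Fin n)) (hz : z ∈ touchingSet Ω x₀) :
    e z ∈ touchingSet (e '' Ω) (e x₀) := by
  have hfr : frontier (e '' Ω) = e '' frontier Ω :=
    (e.toHomeomorph.image_frontier Ω).symm
  refine ⟨hfr ▸ mem_image_of_mem e hz.1, ?_⟩
  rw [e.dist_map, hfr, Metric.infDist_image e.isometry]
  exact hz.2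

end Isometry

end SphericalFlatness

theorem proposition1p1 {m : ℕ} (hm : 1 ≤ m)
    (Ω : Set (EuclideanSpace ℝ (Fin (m + 1)))) (hΩ : IsOpen Ω) (hbdd : Bornology.IsBounded Ω)
    (x₀ z : EuclideanSpace ℝ (Fin (m + 1))) (hx₀ : x₀ ∈ Ω)
    (hz : z ∈ SphericalFlatness.touchingSet Ω x₀)
    (hflat : SphericalFlatness.LipschitzFlat Ω z) :
    SphericalFlatness.sphericalFlatnessIndex Ω x₀ z ≤ 1 := by
  obtain ⟨e, he⟩ := hflat
  rw [← SphericalFlatness.sphericalFlatnessIndex_image e]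
  exact SphericalFlatness.sphericalFlatnessIndex_le_one_of_coordinates hm
    (e.toHomeomorph.isOpenMap Ω hΩ) (mem_image_of_mem e hx₀)
    (SphericalFlatness.image_mem_touchingSet e hz) he
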